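/- Let $t_0,f_0,f_1\in\mathbb{C}^*$. For $\epsilon\in\mathbb{C}$, $0<|\epsilon|<1$, let $t_n=t_0(1+\epsilon)^n$ and let $f_n=f_n(\epsilon)$ be the sequence generated from $f_0,f_1$ by the $q$-difference second Painlevé equation with $a=1$ and $q=1+\epsilon$, $$f_{n+1}f_{n-1}=\frac{1+f_nt_n}{f_n(f_n+t_n)}\qquad(n\ge 1).$$ Put $L_n=f_{n+1}+f_n+\frac1{f_{n+1}}+\frac1{f_n}$ and $$E_0=\frac{f_1^2f_0^2+t_0f_1f_0(f_1+f_0)+t_0(f_1+f_0)+1}{f_1f_0}.$$ Assume $E_0\ne 2\pm4t_0$ and $E_0\neq-2$. Let $c\in\mathbb{C}^*$ be any number with $c^4=\frac{2-E_0-4t_0}{2-E_0+4t_0}$ and set $$\gamma=\frac{(2+E_0)c^2}{2-E_0-4t_0},\qquad \zeta=\frac{8c^2}{2-E_0-4t_0},\qquad \beta=\frac{4+4\gamma^2-\zeta^2}{4\gamma}.$$ Assume that $\beta\notin[-2,2]$, i.e. that $k^2+\beta k+1=0$ does not have its roots on the unit circle. Define $F_n=F_n(\epsilon)\in\mathbb{C}\cup\{\infty\}$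 by $f_n=\frac{c+F_n}{c-F_n}$ (so $F_n=\infty$ if and only if $f_n=-1$). Let $\mathrm{sn}(z;k)$ be Jacobi's elliptic sine of modulus $k$, i.e. the meromorphic function on $\mathbb{C}$ with $(\mathrm{sn}')^2=(1-\mathrm{sn}^2)(1-k^2\mathrm{sn}^2)$, $\mathrm{sn}(0)=0$, $\mathrm{sn}'(0)=1$. Then the following hold. 1. There is exactly one $k\in\mathbb{C}$ with $0<|k|<1$ and $k^2+\beta k+1=0$. 2. For this $k$ the function $\mathrm{sn}(\cdot\,;k)$ exists. Let $A$ be either number with $A^2=k$. There is $z_0\in\mathbb{C}$ with $A\,\mathrm{sn}(z_0;k)=F_0$, and for every such $z_0$ there is $p\in\mathbb{C}$ with $k\,\mathrm{sn}^2(p;k)=-1/\gamma$ such that $$F_n\to A\,\mathrm{sn}(z_0+pn;k)\qquad(\epsilon\to0)$$ in the Riemann sphere $\mathbb{C}\cup\{\infty\}$ (where $\mathrm{sn}=\infty$ at its poles) for every fixed $n$ in the range where the solution stays bounded in the following sense: $n\le N+1$ for some $N\in\mathbb{N}$ such that, for some finite $J$ and all sufficiently small $\epsilon\neq0$, the numbers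 $f_0,\dots,f_{N+1}$ are defined and nonzero and $|L_m|\le J$ for all $0\le m\le N$. Here $z_0$ and $p$ depend neither on $n$ and $N$ nor on $\epsilon$. -/

import Mathlib

open Filter Topology

noncomputable section

/-- `t_n = t₀ (1 + ε)^n`. -/
def qP2Time (t₀ ε : ℂ) (n : ℕ) : ℂ := t₀ * (1 + ε) ^ n

/-- The sequence `f_n` generated from `f₀, f₁` by the `q`-difference second Painlevé equation
with `q = 1 + ε`, solved for the newest iterate. As `x / 0 = 0`, an iterate that is not defined by
the equation gets the value `0`. -/
def qP2Seq (a t₀ ε f₀ f₁ : ℂ) : ℕ → ℂ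
  | 0 => f₀
  | 1 => f₁
  | n + 2 =>
      a * (1 + qP2Seq a t₀ ε f₀ f₁ (n + 1) * qP2Time t₀ ε (n + 1)) /
        (qP2Seq a t₀ ε f₀ f₁ (n + 1) *
          (qP2Seq a t₀ ε f₀ f₁ (n + 1) + qP2Time t₀ ε (n + 1)) * qP2Seq a t₀ ε f₀ f₁ n)

/-- As long as consecutive iterates do not vanish, the sequence satisfies the recurrence
`f_{n+1} f_{n-1} = a (1 + f_n t_n) / (f_n (f_n + t_n))` (here with `n + 1` in place of `n`), and the
denominator in it is not zero. -/
theorem qP2Seq_spec (a t₀ ε f₀ f₁ : ℂ) (n : ℕ) (h₀ : qP2Seq a t₀ ε f₀ f₁ n ≠ 0)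
    (h₁ : qP2Seq a t₀ ε f₀ f₁ (n + 1) ≠ 0) (h₂ : qP2Seq a t₀ ε f₀ f₁ (n + 2) ≠ 0) :
    qP2Seq a t₀ ε f₀ f₁ (n + 1) + qP2Time t₀ ε (n + 1) ≠ 0 ∧
    qP2Seq a t₀ ε f₀ f₁ (n + 2) * qP2Seq a t₀ ε f₀ f₁ n =
      a * (1 + qP2Seq a t₀ ε f₀ f₁ (n + 1) * qP2Time t₀ ε (n + 1)) /
        (qP2Seq a t₀ ε f₀ f₁ (n + 1) *
          (qP2Seq a t₀ ε f₀ f₁ (n + 1) + qP2Time t₀ ε (n + 1))) := by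
  have h₃ : qP2Seq a t₀ ε f₀ f₁ (n + 1) + qP2Time t₀ ε (n + 1) ≠ 0 := by
    intro h
    apply h₂
    rw [qP2Seq, h]
    simp
  refine ⟨h₃, ?_⟩
  rw [qP2Seq]
  field_simp

/-- The quantity `E` of a pair `(x, y) = (f_{n+1}, f_n)`; it is conserved at leading order. -/
def qP2E (a t₀ x y : ℂ) : ℂ :=
  (x ^ 2 * y ^ 2 + t₀ * x * y * (x + y) + a * t₀ * (x + y) + a) / (x * y)

/-- The quantity `L` of a pair `(x, y) = (f_{n+1}, f_n)`. -/
def qP2L (a x y : ℂ) : ℂ := (a + x * y) * (x + y) / (x * y)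

/-- The iterates `f_0, …, f_{N+1}` are nonzero (hence defined by the recurrence) and
`|L_0|, …, |L_N| ≤ J`, with a bound `J` that is the same for all sufficiently small `ε ≠ 0`. -/
def QP2Bounded (a t₀ f₀ f₁ : ℂ) (N : ℕ) : Prop :=
  ∃ J : ℝ, ∀ᶠ ε in 𝓝[≠] (0 : ℂ), ∀ k ≤ N,
    qP2Seq a t₀ ε f₀ f₁ k ≠ 0 ∧ qP2Seq a t₀ ε f₀ f₁ (k + 1) ≠ 0 ∧
    ‖qP2L a (qP2Seq a t₀ ε f₀ f₁ (k + 1)) (qP2Seq a t₀ ε f₀ f₁ k)‖ ≤ J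

open Classical in
/-- The point `F` of the Riemann sphere with `f = (c + F) / (c - F)`; it is `∞` for `f = -1`. -/
def moebiusF (c f : ℂ) : OnePoint ℂ :=
  if f = -1 then OnePoint.infty else ((c * (f - 1) / (f + 1) : ℂ) : OnePoint ℂ)

theorem moebiusF_eq_coe_iff {c : ℂ} (hc : c ≠ 0) (f F : ℂ) :
    moebiusF c f = (F : OnePoint ℂ) ↔ F ≠ c ∧ f = (c + F) / (c - F) := by
  unfold moebiusF
  by_cases h : f = -1
  · rw [if_pos h]
    refine ⟨fun h' => absurd h' (OnePoint.infty_ne_coe F), ?_⟩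
    rintro ⟨h1, h2⟩
    exfalso
    have h3 : c - F ≠ 0 := sub_ne_zero.2 (Ne.symm h1)
    rw [h, eq_div_iff h3] at h2
    apply hc
    linear_combination (-1 / 2 : ℂ) * h2
  · have h4 : f + 1 ≠ 0 := fun h' => h (eq_neg_of_add_eq_zero_left h')
    rw [if_neg h, OnePoint.coe_eq_coe]
    constructor
    · intro h5
      rw [div_eq_iff h4] at h5
      have h6 : F ≠ c := by
        rintro rfl
        apply hc
        linear_combination (-1 / 2 : ℂ) * h5
      have h3 : c - F ≠ 0 := sub_ne_zero.2 (Ne.symm h6)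
      refine ⟨h6, ?_⟩
      rw [eq_div_iff h3]
      linear_combination h5
    · rintro ⟨h1, h2⟩
      have h3 : c - F ≠ 0 := sub_ne_zero.2 (Ne.symm h1)
      rw [eq_div_iff h3] at h2
      rw [div_eq_iff h4]
      linear_combination h2

/-- `s` is Jacobi's elliptic sine `sn(·; k)`: the meromorphic function on `ℂ` with
`(s')² = (1 - s²)(1 - k² s²)`, `s(0) = 0` and `s'(0) = 1`, that is, the inverse of the elliptic
integral `∫₀ ds / √((1 - s²)(1 - k² s²))`. Normal form means that `s` is analytic away from its
poles; at the poles it is given the value `0`. -/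
structure IsJacobiSn (k : ℂ) (s : ℂ → ℂ) : Prop where
  meromorphicNFOn : MeromorphicNFOn s Set.univ
  map_zero : s 0 = 0
  deriv_zero : deriv s 0 = 1
  deriv_sq : ∀ z, AnalyticAt ℂ s z →
    deriv s z ^ 2 = (1 - s z ^ 2) * (1 - k ^ 2 * s z ^ 2)

theorem IsJacobiSn.analyticAt_zero {k : ℂ} {s : ℂ → ℂ} (h : IsJacobiSn k s) :
    AnalyticAt ℂ s 0 := by
  have hd : DifferentiableAt ℂ s 0 := by
    by_contra hn
    have := deriv_zero_of_not_differentiableAt hn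
    rw [h.deriv_zero] at this
    exact one_ne_zero this
  have hnf := h.meromorphicNFOn (Set.mem_univ (0 : ℂ))
  rw [meromorphicNFAt_iff_analyticAt_or] at hnf
  rcases hnf with ha | ⟨-, ho, -⟩
  · exact ha
  · exact absurd (hd.continuousAt.tendsto.mono_left nhdsWithin_le_nhds)
      (not_tendsto_nhds_of_tendsto_atTop
        (tendsto_norm_cobounded_atTop.comp (tendsto_cobounded_of_meromorphicOrderAt_neg ho)) _ |>
          fun hx hy => hx hy.norm)

/-- The elliptic sine is unique. -/
theorem IsJacobiSn.unique {k : ℂ} {s r : ℂ → ℂ} (hs : IsJacobiSn k s) (hr : IsJacobiSn k r) :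
    s = r := by
  have sa := hs.analyticAt_zero
  have ra := hr.analyticAt_zero
  have hD : AnalyticAt ℂ (s - r) 0 := sa.sub ra
  have hD0 : (s - r) 0 = 0 := by simp [hs.map_zero, hr.map_zero]
  set h : ℂ → ℂ := fun z =>
    -(s z + r z) * (1 + k ^ 2 - k ^ 2 * (s z ^ 2 + r z ^ 2)) * (deriv s z + deriv r z)⁻¹ with hh
  have hne : deriv s 0 + deriv r 0 ≠ 0 := by
    rw [hs.deriv_zero, hr.deriv_zero]
    norm_num
  have ha : AnalyticAt ℂ h 0 := by
    have h1 : AnalyticAt ℂ (fun z => (deriv s z + deriv r z)⁻¹) 0 :=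
      (sa.deriv.add ra.deriv).inv hne
    have h2 : AnalyticAt ℂ
        (fun z => -(s z + r z) * (1 + k ^ 2 - k ^ 2 * (s z ^ 2 + r z ^ 2))) 0 := by
      fun_prop
    exact h2.mul h1
  have hderiv : deriv (s - r) =ᶠ[𝓝 0] (s - r) * h := by
    have hc : ContinuousAt (fun z => deriv s z + deriv r z) 0 :=
      (sa.deriv.add ra.deriv).continuousAt
    filter_upwards [sa.eventually_analyticAt, ra.eventually_analyticAt,
      hc.eventually_ne hne] with z h1 h2 h3
    rw [deriv_sub h1.differentiableAt h2.differentiableAt]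
    simp only [Pi.mul_apply, Pi.sub_apply, hh]
    have e1 := hs.deriv_sq z h1
    have e2 := hr.deriv_sq z h2
    field_simp
    linear_combination e1 - e2
  have hord := hD.analyticOrderAt_deriv_add_one
  have htop : analyticOrderAt (s - r) 0 = ⊤ := by
    by_contra hnt
    rw [analyticOrderAt_congr hderiv, analyticOrderAt_mul hD ha] at hord
    have : (fun z => (s - r) z - (s - r) 0) = s - r := by
      funext z
      rw [hD0, sub_zero]
    rw [this] at hord
    obtain ⟨m, hm⟩ := ENat.ne_top_iff_exists.1 hnt
    rw [← hm] at hord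
    rcases eq_or_ne (analyticOrderAt h 0) ⊤ with h4 | h4
    · rw [h4] at hord
      simp at hord
    · obtain ⟨j, hj⟩ := ENat.ne_top_iff_exists.1 h4
      rw [← hj] at hord
      norm_cast at hord
      omega
  have hM : MeromorphicOn (s - r) Set.univ :=
    hs.meromorphicNFOn.meromorphicOn.sub hr.meromorphicNFOn.meromorphicOn
  have hm0 : meromorphicOrderAt (s - r) 0 = ⊤ := by
    rw [hD.meromorphicOrderAt_eq, htop]
    rfl
  funext z
  have hz : meromorphicOrderAt (s - r) z = ⊤ := by
    by_contra hnz
    exact hM.meromorphicOrderAt_ne_top_of_isPreconnected isPreconnected_univ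
      (Set.mem_univ z) (Set.mem_univ 0) hnz hm0
  rw [meromorphicOrderAt_eq_top_iff] at hz
  have he : s =ᶠ[𝓝[≠] z] r := by
    filter_upwards [hz] with w hw
    exact sub_eq_zero.1 hw
  exact (((hs.meromorphicNFOn (Set.mem_univ z)).eventuallyEq_nhdsNE_iff_eventuallyEq_nhds
    (hr.meromorphicNFOn (Set.mem_univ z))).1 he).self_of_nhds

open Classical in
/-- Jacobi's elliptic sine `sn(z; k)` of modulus `k`, with the value `0` at its poles. -/
def jacobiSn (k : ℂ) : ℂ → ℂ :=
  if h : ∃ s : ℂ → ℂ, IsJacobiSn k s then h.choose else 0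

theorem IsJacobiSn.eq_jacobiSn {k : ℂ} {s : ℂ → ℂ} (h : IsJacobiSn k s) : jacobiSn k = s := by
  have he : ∃ s : ℂ → ℂ, IsJacobiSn k s := ⟨s, h⟩
  unfold jacobiSn
  rw [dif_pos he]
  exact he.choose_spec.unique h

open Classical in
/-- `A sn(z; k)` as a point of the Riemann sphere: it is `∞` where `sn(·; k)` has a pole. -/
def scaledSn (A k z : ℂ) : OnePoint ℂ :=
  if AnalyticAt ℂ (jacobiSn k) z then ((A * jacobiSn k z : ℂ) : OnePoint ℂ) else OnePoint.infty

end

/-! As `ε → 0` the equation becomes autonomous and `E` becomes a first integral. For fixed `y =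
f_n`, the two neighbours `f_{n±1}` are the roots of `y (y + t) X² + (t y² + t - E y) X + (1 + t y) =
0`, so an orbit lives on a symmetric biquadratic curve. The Möbius map from `f` to `F` puts this
curve into Euler's form `(F² + γ) X² + ζ F X + γ F² + 1 = 0`. By the addition formula, with `F = A
sn w`, the roots are `A sn (w ± p)` as soon as `k sn² p = -1/γ` and `sn' p = -ζ/(2γ)`; the
definition of `β` says exactly that such a point lies on the curve of `(sn, sn')`. Hence one step of
the map is translation by `p` (`IsJacobiSn.moebiusSn_vieta`, `exists_moebiusSn_shift`,
`tendsto_moebiusSn_orbit`).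

The bound on `L` keeps the limits of the iterates away from `0` and `∞`, so that `f_n(ε)` converges
to the autonomous orbit (`qP2_limit_step`, `QP2Bounded.limit`); `E ≠ -2` excludes the indeterminate
case `0/0`.

The theory of `sn` is built from its differential equation: a local inverse of the elliptic integral
is continued to the plane by the duplication formula (`exists_isJacobiSn`); addition comes from
uniqueness for the equation, surjectivity from addition, and a pole from duplication. -/

/-! ### Local uniqueness for the elliptic differential equation. -/

theorem AnalyticAt.eventuallyEq_of_second_order_ode {u v : ℂ → ℂ} {a α β : ℂ}
    (hu : AnalyticAt ℂ u a) (hv : AnalyticAt ℂ v a)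
    (hu' : ∀ᶠ z in 𝓝 a, deriv (deriv u) z = α * u z + β * u z ^ 3)
    (hv' : ∀ᶠ z in 𝓝 a, deriv (deriv v) z = α * v z + β * v z ^ 3)
    (h0 : u a = v a) (h1 : deriv u a = deriv v a) : u =ᶠ[𝓝 a] v := by
  have hD : AnalyticAt ℂ (u - v) a := hu.sub hv
  set h : ℂ → ℂ := fun z => α + β * (u z ^ 2 + u z * v z + v z ^ 2) with hh
  have ha : AnalyticAt ℂ h a := by fun_prop
  have hd1 : deriv (u - v) =ᶠ[𝓝 a] deriv u - deriv v := by
    filter_upwards [hu.eventually_analyticAt, hv.eventually_analyticAt] with z h1 h2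
    exact deriv_sub h1.differentiableAt h2.differentiableAt
  -- The difference solves a linear equation. As it vanishes at `a` with its derivative, a finite
  -- order of vanishing would drop by two under two differentiations, yet multiplication by `h`
  -- cannot lower it.
  have hd2 : deriv (deriv (u - v)) =ᶠ[𝓝 a] (u - v) * h := by
    filter_upwards [hd1.eventuallyEq_nhds, hu.eventually_analyticAt, hv.eventually_analyticAt,
      hu', hv'] with z hz h1 h2 h3 h4
    rw [hz.deriv_eq, deriv_sub h1.deriv.differentiableAt h2.deriv.differentiableAt, h3, h4]
    simp only [hh, Pi.mul_apply, Pi.sub_apply]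
    ring
  have e0 : (u - v) a = 0 := by simp [h0]
  have e1 : deriv (u - v) a = 0 := by rw [hd1.self_of_nhds]; simp [h1]
  have o1 := hD.analyticOrderAt_deriv_add_one
  have o2 := hD.deriv.analyticOrderAt_deriv_add_one
  simp only [e0, e1, sub_zero] at o1 o2
  rw [analyticOrderAt_congr hd2, analyticOrderAt_mul hD ha] at o2
  have htop : analyticOrderAt (u - v) a = ⊤ := by
    by_contra hnt
    obtain ⟨m, hm⟩ := ENat.ne_top_iff_exists.1 hnt
    have o1' : analyticOrderAt (deriv (u - v)) a + 1 = analyticOrderAt (u - v) a := o1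
    have o2' : analyticOrderAt (u - v) a + analyticOrderAt h a + 1
      = analyticOrderAt (deriv (u - v)) a := o2
    rw [← o2', ← hm] at o1'
    rcases eq_or_ne (analyticOrderAt h a) ⊤ with h4 | h4
    · rw [h4] at o1'
      simp at o1'
    · obtain ⟨j, hj⟩ := ENat.ne_top_iff_exists.1 h4
      rw [← hj] at o1'
      norm_cast at o1'
      omega
  filter_upwards [analyticOrderAt_eq_top.1 htop] with z hz
  exact sub_eq_zero.1 hz

/-- Differentiate the first-order equation and cancel `2 u'`. The gain is that the new equation has
unique solutions even where `u' = 0`. -/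
theorem AnalyticAt.second_order_ode_of_sq {k a : ℂ} {u : ℂ → ℂ} (hu : AnalyticAt ℂ u a)
    (h : ∀ᶠ z in 𝓝 a, deriv u z ^ 2 = (1 - u z ^ 2) * (1 - k ^ 2 * u z ^ 2))
    (h1 : deriv u a ≠ 0) :
    ∀ᶠ z in 𝓝 a, deriv (deriv u) z = -(1 + k ^ 2) * u z + 2 * k ^ 2 * u z ^ 3 := by
  filter_upwards [eventually_eventually_nhds.2 h, hu.eventually_analyticAt,
    hu.deriv.continuousAt.eventually_ne h1] with z hz hz1 hz2
  have hL : HasDerivAt (fun z => deriv u z ^ 2) (2 * deriv u z * deriv (deriv u) z) z := by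
    simpa using hz1.deriv.differentiableAt.hasDerivAt.fun_pow 2
  have hu1 := hz1.differentiableAt.hasDerivAt
  have hR : HasDerivAt (fun z => (1 - u z ^ 2) * (1 - k ^ 2 * u z ^ 2))
      ((-(2 * u z * deriv u z)) * (1 - k ^ 2 * u z ^ 2)
        + (1 - u z ^ 2) * (-(k ^ 2 * (2 * u z * deriv u z)))) z := by
    have h2 : HasDerivAt (fun z => u z ^ 2) (2 * u z * deriv u z) z := by simpa using hu1.fun_pow 2
    exact (h2.const_sub 1).mul ((h2.const_mul (k ^ 2)).const_sub 1)
  have he := hL.unique (hR.congr_of_eventuallyEq hz)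
  apply mul_left_cancel₀ (mul_ne_zero two_ne_zero hz2)
  rw [he]
  ring

theorem AnalyticAt.eventuallyEq_of_sq_ode {k a : ℂ} {u v : ℂ → ℂ} (hu : AnalyticAt ℂ u a)
    (hv : AnalyticAt ℂ v a)
    (hu' : ∀ᶠ z in 𝓝 a, deriv u z ^ 2 = (1 - u z ^ 2) * (1 - k ^ 2 * u z ^ 2))
    (hv' : ∀ᶠ z in 𝓝 a, deriv v z ^ 2 = (1 - v z ^ 2) * (1 - k ^ 2 * v z ^ 2))
    (h0 : u a = v a) (h1 : deriv u a = deriv v a) (h2 : deriv u a ≠ 0) : u =ᶠ[𝓝 a] v :=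
  hu.eventuallyEq_of_second_order_ode hv (hu.second_order_ode_of_sq hu' h2)
    (hv.second_order_ode_of_sq hv' (h1 ▸ h2)) h0 h1

/-! ### Existence of the elliptic sine. -/

/-- A germ at `0` of the elliptic sine of modulus `k`. -/
structure IsSnGerm (k : ℂ) (s : ℂ → ℂ) : Prop where
  analyticAt : AnalyticAt ℂ s 0
  map_zero : s 0 = 0
  deriv_zero : deriv s 0 = 1
  deriv_sq : ∀ᶠ z in 𝓝 0, deriv s z ^ 2 = (1 - s z ^ 2) * (1 - k ^ 2 * s z ^ 2)

theorem IsSnGerm.eventuallyEq {k : ℂ} {s r : ℂ → ℂ} (hs : IsSnGerm k s) (hr : IsSnGerm k r) :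
    s =ᶠ[𝓝 0] r :=
  hs.analyticAt.eventuallyEq_of_sq_ode hr.analyticAt hs.deriv_sq hr.deriv_sq
    (by rw [hs.map_zero, hr.map_zero]) (by rw [hs.deriv_zero, hr.deriv_zero])
    (by rw [hs.deriv_zero]; exact one_ne_zero)

/-- The elliptic integral of the first kind has a local inverse. -/
theorem exists_isSnGerm (k : ℂ) : ∃ s : ℂ → ℂ, IsSnGerm k s := by
  set P : ℂ → ℂ := fun x => (1 - x ^ 2) * (1 - k ^ 2 * x ^ 2) with hP
  have hPa : AnalyticAt ℂ P 0 := by fun_prop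
  have hP0 : P 0 = 1 := by simp [hP]
  -- The branch of `P ^ (-1/2)` near `0` with value `1` there; its primitive `U` is the elliptic
  -- integral.
  set Q : ℂ → ℂ := fun x => Complex.exp (-(1 / 2) * Complex.log (P x)) with hQ
  have hslit : P 0 ∈ Complex.slitPlane := by rw [hP0]; exact Complex.one_mem_slitPlane
  have hQa : AnalyticAt ℂ Q 0 := by
    have : AnalyticAt ℂ (fun x => Complex.log (P x)) 0 := hPa.clog hslit
    exact (analyticAt_const.mul this).cexp
  have hQ0 : Q 0 = 1 := by simp [hQ, hP0]
  have hPne : ∀ᶠ x in 𝓝 (0 : ℂ), P x ≠ 0 :=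
    hPa.continuousAt.eventually_ne (by rw [hP0]; exact one_ne_zero)
  have hQP : ∀ᶠ x in 𝓝 (0 : ℂ), Q x ^ 2 * P x = 1 := by
    filter_upwards [hPne] with x hx
    have : P x = Complex.exp (Complex.log (P x)) := (Complex.exp_log hx).symm
    simp only [hQ]
    rw [← Complex.exp_nat_mul]
    nth_rw 2 [this]
    rw [← Complex.exp_add]
    rw [show ((2 : ℕ) : ℂ) * (-(1 / 2) * Complex.log (P x)) + Complex.log (P x) = 0 by
      push_cast; ring, Complex.exp_zero]
  obtain ⟨ρ, hρ, hball⟩ := Metric.eventually_nhds_iff_ball.1 hQa.eventually_analyticAt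
  have hdiff : DifferentiableOn ℂ Q (Metric.ball 0 ρ) := fun z hz =>
    (hball z hz).differentiableAt.differentiableWithinAt
  obtain ⟨U, hU0, hU⟩ := hdiff.isExactOn_ball.with_val_at 0 0
  have hUd : DifferentiableOn ℂ U (Metric.ball 0 ρ) := fun z hz =>
    (hU z hz).differentiableAt.differentiableWithinAt
  have hUa : AnalyticAt ℂ U 0 := hUd.analyticAt (Metric.ball_mem_nhds 0 hρ)
  have hU1 : deriv U 0 = 1 := by rw [(hU 0 (Metric.mem_ball_self hρ)).deriv, hQ0]
  have hU1' : deriv U 0 ≠ 0 := by rw [hU1]; exact one_ne_zero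
  set s := hUa.hasStrictDerivAt.localInverse _ _ _ hU1' with hs
  have hsa : AnalyticAt ℂ s 0 := by
    have := hUa.analyticAt_localInverse hU1'
    rwa [hU0] at this
  have hs0 : s 0 = 0 := by
    have : s (U 0) = 0 := HasStrictFDerivAt.localInverse_apply_image ..
    rwa [hU0] at this
  have hUs : ∀ᶠ z in 𝓝 0, U (s z) = z := by
    have := hUa.hasStrictDerivAt.eventually_right_inverse hU1'
    rwa [hU0] at this
  have hst : Tendsto s (𝓝 0) (𝓝 0) := by
    have := hsa.continuousAt.tendsto
    rwa [hs0] at this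
  have hder : ∀ᶠ z in 𝓝 0, Q (s z) * deriv s z = 1 := by
    filter_upwards [eventually_eventually_nhds.2 hUs, hsa.eventually_analyticAt,
      hst.eventually (Metric.ball_mem_nhds 0 hρ)] with z h1 h2 h3
    have h4 := (hU (s z) h3).comp z h2.differentiableAt.hasDerivAt
    have h5 : HasDerivAt (U ∘ s) 1 z := (hasDerivAt_id z).congr_of_eventuallyEq h1
    exact h4.unique h5
  refine ⟨s, hsa, hs0, ?_, ?_⟩
  · have := hder.self_of_nhds
    rwa [hs0, hQ0, one_mul] at this
  · filter_upwards [hder, hst.eventually hQP] with z h1 h2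
    change deriv s z ^ 2 = P (s z)
    linear_combination (-(deriv s z) ^ 2) * h2 + P (s z) * (Q (s z) * deriv s z + 1) * h1

/-- The right-hand side of the duplication formula of the elliptic sine. -/
noncomputable def snDouble (k : ℂ) (s : ℂ → ℂ) (z : ℂ) : ℂ :=
  2 * s (z / 2) * deriv s (z / 2) / (1 - k ^ 2 * s (z / 2) ^ 4)

theorem snDouble_sq_identity {k x y D : ℂ} (hD : D = 1 - k ^ 2 * x ^ 4) (hD0 : D ≠ 0)
    (h : y ^ 2 = (1 - x ^ 2) * (1 - k ^ 2 * x ^ 2)) :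
    (((y ^ 2 + x * (-(1 + k ^ 2) * x + 2 * k ^ 2 * x ^ 3)) * D + 4 * k ^ 2 * x ^ 4 * y ^ 2) /
      D ^ 2) ^ 2 = (1 - (2 * x * y / D) ^ 2) * (1 - k ^ 2 * (2 * x * y / D) ^ 2) := by
  have h1 : (2 * x * y / D) ^ 2 = 4 * x ^ 2 * ((1 - x ^ 2) * (1 - k ^ 2 * x ^ 2)) / D ^ 2 := by
    rw [← h]; ring
  rw [h1, h]
  field_simp
  rw [hD]
  ring

theorem IsSnGerm.snDouble {k : ℂ} {s : ℂ → ℂ} (hs : IsSnGerm k s) :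
    IsSnGerm k (snDouble k s) := by
  have hhalf : AnalyticAt ℂ (fun z : ℂ => z / 2) 0 := by fun_prop
  have hht : Tendsto (fun z : ℂ => z / 2) (𝓝 0) (𝓝 0) := by
    simpa using hhalf.continuousAt.tendsto
  have ha : AnalyticAt ℂ (fun z => s (z / 2)) 0 :=
    AnalyticAt.fun_comp (by simpa using hs.analyticAt) hhalf
  have hb : AnalyticAt ℂ (fun z => deriv s (z / 2)) 0 :=
    AnalyticAt.fun_comp (by simpa using hs.analyticAt.deriv) hhalf
  have hden : AnalyticAt ℂ (fun z => 1 - k ^ 2 * s (z / 2) ^ 4) 0 :=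
    analyticAt_const.sub (analyticAt_const.mul (ha.fun_pow 4))
  have hden0 : (fun z => 1 - k ^ 2 * s (z / 2) ^ 4) 0 ≠ 0 := by simp [hs.map_zero]
  have h2 := hs.analyticAt.second_order_ode_of_sq hs.deriv_sq
    (by rw [hs.deriv_zero]; exact one_ne_zero)
  have key : ∀ᶠ z in 𝓝 (0 : ℂ), deriv (_root_.snDouble k s) z =
      ((deriv s (z / 2) ^ 2 + s (z / 2) * deriv (deriv s) (z / 2)) *
        (1 - k ^ 2 * s (z / 2) ^ 4) + 4 * k ^ 2 * s (z / 2) ^ 4 * deriv s (z / 2) ^ 2) /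
        (1 - k ^ 2 * s (z / 2) ^ 4) ^ 2 := by
    filter_upwards [hden.continuousAt.eventually_ne hden0,
      hht.eventually hs.analyticAt.eventually_analyticAt] with z h3 h4
    have e1 : HasDerivAt (fun z => s (z / 2)) (deriv s (z / 2) * (1 / 2)) z :=
      h4.differentiableAt.hasDerivAt.comp z ((hasDerivAt_id z).div_const 2)
    have e2 : HasDerivAt (fun z => deriv s (z / 2)) (deriv (deriv s) (z / 2) * (1 / 2)) z :=
      HasDerivAt.comp (h₂ := deriv s) z h4.deriv.differentiableAt.hasDerivAt ((hasDerivAt_id z).div_const 2)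
    have e3 := ((e1.const_mul 2).fun_mul e2).fun_div (((e1.fun_pow 4).const_mul (k ^ 2)).const_sub 1) h3
    refine (e3.deriv).trans ?_
    congr 1
    push_cast
    ring
  refine ⟨?_, ?_, ?_, ?_⟩
  · exact ((analyticAt_const.mul ha).mul hb).div hden hden0
  · simp [_root_.snDouble, hs.map_zero]
  · rw [key.self_of_nhds]
    simp [hs.map_zero, hs.deriv_zero]
  · filter_upwards [key, hden.continuousAt.eventually_ne hden0, hht.eventually h2,
      hht.eventually hs.deriv_sq] with z h3 h4 h5 h6
    rw [h3, h5]
    exact snDouble_sq_identity rfl h4 h6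

theorem MeromorphicOn.eventuallyEq_nhdsNE_of_isPreconnected {f g : ℂ → ℂ} {U : Set ℂ} {a b : ℂ}
    (hf : MeromorphicOn f U) (hg : MeromorphicOn g U) (hU : IsPreconnected U) (ha : a ∈ U)
    (hb : b ∈ U) (h : f =ᶠ[𝓝[≠] a] g) : f =ᶠ[𝓝[≠] b] g := by
  have hM : MeromorphicOn (f - g) U := hf.sub hg
  have hm0 : meromorphicOrderAt (f - g) a = ⊤ := by
    rw [meromorphicOrderAt_eq_top_iff]
    filter_upwards [h] with z hz
    simp [hz]
  have hz : meromorphicOrderAt (f - g) b = ⊤ := by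
    by_contra hnz
    exact hM.meromorphicOrderAt_ne_top_of_isPreconnected hU hb ha hnz hm0
  rw [meromorphicOrderAt_eq_top_iff] at hz
  filter_upwards [hz] with w hw
  exact sub_eq_zero.1 hw

theorem Meromorphic.eventuallyEq_nhdsNE {f g : ℂ → ℂ} {a : ℂ} (hf : Meromorphic f)
    (hg : Meromorphic g) (h : f =ᶠ[𝓝[≠] a] g) (b : ℂ) : f =ᶠ[𝓝[≠] b] g :=
  hf.meromorphicOn.eventuallyEq_nhdsNE_of_isPreconnected hg.meromorphicOn isPreconnected_univ
    (Set.mem_univ a) (Set.mem_univ b) h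

theorem MeromorphicOn.snDouble {k : ℂ} {s : ℂ → ℂ} {ρ : ℝ}
    (hs : MeromorphicOn s (Metric.ball 0 ρ)) :
    MeromorphicOn (snDouble k s) (Metric.ball 0 (2 * ρ)) := by
  intro z hz
  have hz2 : z / 2 ∈ Metric.ball (0 : ℂ) ρ := by
    rw [mem_ball_zero_iff] at hz ⊢
    rw [norm_div, RCLike.norm_ofNat]
    linarith
  have hhalf : AnalyticAt ℂ (fun z : ℂ => z / 2) z := by fun_prop
  have h1 : MeromorphicAt (fun z => s (z / 2)) z :=
    MeromorphicAt.comp_analyticAt (f := s) (hs _ hz2) hhalf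
  have h2 : MeromorphicAt (fun z => deriv s (z / 2)) z :=
    MeromorphicAt.comp_analyticAt (f := deriv s) (hs _ hz2).deriv hhalf
  exact (((MeromorphicAt.const 2 z).fun_mul h1).fun_mul h2).fun_div
    ((MeromorphicAt.const 1 z).fun_sub ((MeromorphicAt.const _ z).fun_mul (h1.fun_pow 4)))

/-- The duplication formula sends a germ of `sn` to a germ of `sn` and doubles the radius of the
disc of meromorphy. Its iterates agree by the identity theorem and glue to a function on the plane.
-/
theorem exists_isJacobiSn (k : ℂ) : ∃ s : ℂ → ℂ, IsJacobiSn k s := by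
  obtain ⟨s₀, hs₀⟩ := exists_isSnGerm k
  obtain ⟨r, hr, hball⟩ := Metric.eventually_nhds_iff_ball.1 hs₀.analyticAt.eventually_analyticAt
  set S : ℕ → ℂ → ℂ := fun n => (snDouble k)^[n] s₀ with hS
  have hS1 : ∀ n, S (n + 1) = snDouble k (S n) := fun n => Function.iterate_succ_apply' _ _ _
  have hgerm : ∀ n, IsSnGerm k (S n) := by
    intro n
    induction n with
    | zero => exact hs₀
    | succ n ih => rw [hS1]; exact ih.snDouble
  set B : ℕ → Set ℂ := fun n => Metric.ball 0 (2 ^ n * r) with hB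
  have hmer : ∀ n, MeromorphicOn (S n) (B n) := by
    intro n
    induction n with
    | zero => intro z hz; exact (hball z (by simpa [hB] using hz)).meromorphicAt
    | succ n ih =>
      have := ih.snDouble (k := k)
      rw [hS1]
      rwa [← mul_assoc, ← pow_succ'] at this
  have hmono : ∀ {m n}, m ≤ n → B m ⊆ B n := fun hmn =>
    Metric.ball_subset_ball (by gcongr; norm_num)
  have h0 : ∀ n, (0 : ℂ) ∈ B n := fun n => Metric.mem_ball_self (by positivity)
  have hcompat : ∀ {m n} {x : ℂ}, m ≤ n → x ∈ B m → S m =ᶠ[𝓝[≠] x] S n := fun {m n x} hmn hx =>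
    (hmer m).eventuallyEq_nhdsNE_of_isPreconnected ((hmer n).mono_set (hmono hmn))
      (convex_ball _ _).isPreconnected (h0 m) hx
      (((hgerm m).eventuallyEq (hgerm n)).filter_mono nhdsWithin_le_nhds)
  have hex : ∀ x, ∃ n, x ∈ B n := by
    intro x
    obtain ⟨n, hn⟩ := pow_unbounded_of_one_lt (‖x‖ / r) one_lt_two
    refine ⟨n, ?_⟩
    rw [hB, mem_ball_zero_iff]
    rwa [div_lt_iff₀ hr] at hn
  choose N hN using hex
  -- The `S n` agree only on punctured neighbourhoods; passing to normal form makes the value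
  -- independent of the chosen disc.
  set s : ℂ → ℂ := fun x => toMeromorphicNFAt (S (N x)) x x with hs
  have hsT : ∀ n, ∀ x ∈ B n, s x = toMeromorphicNFOn (S n) (B n) x := by
    intro n x hx
    rw [toMeromorphicNFOn_eq_toMeromorphicNFAt (hmer n) hx]
    have : S (N x) =ᶠ[𝓝[≠] x] S n := by
      rcases le_total n (N x) with h | h
      · exact (hcompat h hx).symm
      · exact hcompat h (hN x)
    exact (toMeromorphicNFAt_eventuallyEq_nhds_congr this).self_of_nhds
  have hsT' : ∀ n, ∀ x ∈ B n, s =ᶠ[𝓝 x] toMeromorphicNFOn (S n) (B n) := by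
    intro n x hx
    filter_upwards [Metric.isOpen_ball.mem_nhds hx] with y hy using hsT n y hy
  have hNF : MeromorphicNFOn s Set.univ := by
    intro x _
    rw [meromorphicNFAt_congr (hsT' (N x) x (hN x))]
    exact meromorphicNFOn_toMeromorphicNFOn _ _ (hN x)
  have hss₀ : s =ᶠ[𝓝 0] s₀ := by
    refine ((hNF (Set.mem_univ 0)).eventuallyEq_nhdsNE_iff_eventuallyEq_nhds
      hs₀.analyticAt.meromorphicNFAt).1 ?_
    exact ((hsT' 0 0 (h0 0)).filter_mono nhdsWithin_le_nhds).trans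
      ((hmer 0).toMeromorphicNFOn_eq_self_on_nhdsNE (h0 0))
  refine ⟨s, hNF, ?_, ?_, ?_⟩
  · rw [hss₀.self_of_nhds, hs₀.map_zero]
  · rw [hss₀.deriv_eq, hs₀.deriv_zero]
  · intro z hz
    have hsm : Meromorphic s := fun x => hNF.meromorphicOn x (Set.mem_univ x)
    have hode : (fun z => deriv s z ^ 2) =ᶠ[𝓝[≠] z]
        fun z => (1 - s z ^ 2) * (1 - k ^ 2 * s z ^ 2) := by
      refine Meromorphic.eventuallyEq_nhdsNE (a := 0) (by fun_prop) (by fun_prop) ?_ z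
      refine Filter.EventuallyEq.filter_mono ?_ nhdsWithin_le_nhds
      filter_upwards [hs₀.deriv_sq, hss₀, hss₀.deriv] with w h1 h2 h3
      rw [h2, h3, h1]
    have hz' := hz.deriv
    exact ((ContinuousAt.eventuallyEq_nhds_iff_eventuallyEq_nhdsNE
      (hz'.pow 2).continuousAt (by fun_prop)).1 hode).self_of_nhds

theorem isJacobiSn_jacobiSn (k : ℂ) : IsJacobiSn k (jacobiSn k) := by
  obtain ⟨s, hs⟩ := exists_isJacobiSn k
  rwa [hs.eq_jacobiSn]

/-! ### Second-order equation and oddness of `sn`. -/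

theorem Meromorphic.comp_analytic {f g : ℂ → ℂ} (hf : Meromorphic f)
    (hg : ∀ z, AnalyticAt ℂ g z) : Meromorphic fun z => f (g z) :=
  fun z => MeromorphicAt.comp_analyticAt (f := f) (hf (g z)) (hg z)

namespace IsJacobiSn

variable {k : ℂ} {s : ℂ → ℂ}

theorem meromorphic (hs : IsJacobiSn k s) : Meromorphic s :=
  fun z => hs.meromorphicNFOn.meromorphicOn z (Set.mem_univ z)

theorem isSnGerm (hs : IsJacobiSn k s) : IsSnGerm k s where
  analyticAt := hs.analyticAt_zero
  map_zero := hs.map_zero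
  deriv_zero := hs.deriv_zero
  deriv_sq := by
    filter_upwards [hs.analyticAt_zero.eventually_analyticAt] with z hz using hs.deriv_sq z hz

theorem eventuallyEq_of_nhdsNE (hs : IsJacobiSn k s) {g : ℂ → ℂ} {z : ℂ} (hg : AnalyticAt ℂ g z)
    (h : s =ᶠ[𝓝[≠] z] g) : s =ᶠ[𝓝 z] g :=
  ((hs.meromorphicNFOn (Set.mem_univ z)).eventuallyEq_nhdsNE_iff_eventuallyEq_nhds
    hg.meromorphicNFAt).1 h

theorem analyticAt_of_nhdsNE (hs : IsJacobiSn k s) {g : ℂ → ℂ} {z : ℂ} (hg : AnalyticAt ℂ g z)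
    (h : s =ᶠ[𝓝[≠] z] g) : AnalyticAt ℂ s z :=
  hg.congr (hs.eventuallyEq_of_nhdsNE hg h).symm

/-- The identity theorem carries the equation from `0` to every regular point, including the zeros
of `s'`, where cancellation is impossible. -/
theorem deriv_deriv (hs : IsJacobiSn k s) {z : ℂ} (hz : AnalyticAt ℂ s z) :
    deriv (deriv s) z = -(1 + k ^ 2) * s z + 2 * k ^ 2 * s z ^ 3 := by
  have hm := hs.meromorphic
  have h := Meromorphic.eventuallyEq_nhdsNE (f := deriv (deriv s))
    (g := fun z => -(1 + k ^ 2) * s z + 2 * k ^ 2 * s z ^ 3) (a := 0) hm.deriv.deriv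
    (by fun_prop) ((hs.analyticAt_zero.second_order_ode_of_sq hs.isSnGerm.deriv_sq
      (by rw [hs.deriv_zero]; exact one_ne_zero)).filter_mono nhdsWithin_le_nhds) z
  exact ((ContinuousAt.eventuallyEq_nhds_iff_eventuallyEq_nhdsNE
      hz.deriv.deriv.continuousAt (by fun_prop)).1 h).self_of_nhds

theorem eventually_deriv_deriv (hs : IsJacobiSn k s) {z : ℂ} (hz : AnalyticAt ℂ s z) :
    ∀ᶠ w in 𝓝 z, deriv (deriv s) w = -(1 + k ^ 2) * s w + 2 * k ^ 2 * s w ^ 3 := by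
  filter_upwards [hz.eventually_analyticAt] with w hw using hs.deriv_deriv hw

theorem neg_eventuallyEq (hs : IsJacobiSn k s) {z : ℂ} (hz : AnalyticAt ℂ s z) :
    s =ᶠ[𝓝 (-z)] fun w => -s (-w) := by
  have hm := hs.meromorphic
  have hd : ∀ w, deriv (fun w => -s (-w)) w = deriv s (-w) := by
    intro w
    rw [deriv.fun_neg, deriv_comp_neg, neg_neg]
  have ha0 : AnalyticAt ℂ (fun w => -s (-w)) 0 :=
    (AnalyticAt.fun_comp (g := s) (by simpa using hs.analyticAt_zero) analyticAt_id.neg).neg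
  have hg : IsSnGerm k fun w => -s (-w) := by
    refine ⟨ha0, by simp [hs.map_zero], by simp [hd, hs.deriv_zero], ?_⟩
    have ht : Tendsto (fun w : ℂ => -w) (𝓝 0) (𝓝 0) := by simpa using tendsto_neg (0 : ℂ)
    filter_upwards [ht.eventually hs.isSnGerm.deriv_sq] with w hw
    rw [hd, hw]
    ring
  refine hs.eventuallyEq_of_nhdsNE ?_ (hm.eventuallyEq_nhdsNE ?_
    ((hs.isSnGerm.eventuallyEq hg).filter_mono nhdsWithin_le_nhds) (-z))
  · exact (AnalyticAt.fun_comp (g := s) (by simpa using hz) analyticAt_id.neg).neg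
  · exact (hm.comp_analytic (g := fun w => -w) fun _ => by fun_prop).neg

theorem analyticAt_neg (hs : IsJacobiSn k s) {z : ℂ} (hz : AnalyticAt ℂ s z) :
    AnalyticAt ℂ s (-z) :=
  AnalyticAt.congr (AnalyticAt.fun_comp (g := s) (by simpa using hz) analyticAt_id.neg).neg
    (hs.neg_eventuallyEq hz).symm

theorem map_neg (hs : IsJacobiSn k s) {z : ℂ} (hz : AnalyticAt ℂ s z) : s (-z) = -s z := by
  simpa using (hs.neg_eventuallyEq hz).self_of_nhds

theorem deriv_neg (hs : IsJacobiSn k s) {z : ℂ} (hz : AnalyticAt ℂ s z) :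
    deriv s (-z) = deriv s z := by
  rw [(hs.neg_eventuallyEq hz).deriv_eq, deriv.fun_neg, deriv_comp_neg, neg_neg, neg_neg]

end IsJacobiSn

/-! ### The addition formula. -/

/-- The right-hand side of the addition formula of the elliptic sine, for the addition of a point
with coordinates `(a, b)`. -/
noncomputable def snAdd (k : ℂ) (s : ℂ → ℂ) (a b z : ℂ) : ℂ :=
  (s z * b + deriv s z * a) / (1 - k ^ 2 * s z ^ 2 * a ^ 2)

/-- The derivative of `snAdd`. -/
noncomputable def snAddDeriv (k : ℂ) (s : ℂ → ℂ) (a b z : ℂ) : ℂ :=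
  ((deriv s z * b + (-(1 + k ^ 2) * s z + 2 * k ^ 2 * s z ^ 3) * a) *
      (1 - k ^ 2 * s z ^ 2 * a ^ 2) +
    2 * k ^ 2 * s z * deriv s z * a ^ 2 * (s z * b + deriv s z * a)) /
    (1 - k ^ 2 * s z ^ 2 * a ^ 2) ^ 2

theorem snAdd_sq_identity {k x y a b D : ℂ} (hD : D = 1 - k ^ 2 * x ^ 2 * a ^ 2) (hD0 : D ≠ 0)
    (h : y ^ 2 = (1 - x ^ 2) * (1 - k ^ 2 * x ^ 2))
    (h' : b ^ 2 = (1 - a ^ 2) * (1 - k ^ 2 * a ^ 2)) :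
    (((y * b + (-(1 + k ^ 2) * x + 2 * k ^ 2 * x ^ 3) * a) * D +
      2 * k ^ 2 * x * y * a ^ 2 * (x * b + y * a)) / D ^ 2) ^ 2 =
    (1 - ((x * b + y * a) / D) ^ 2) * (1 - k ^ 2 * ((x * b + y * a) / D) ^ 2) := by
  have hN : (x * b + y * a) ^ 2 = x ^ 2 * ((1 - a ^ 2) * (1 - k ^ 2 * a ^ 2)) +
      a ^ 2 * ((1 - x ^ 2) * (1 - k ^ 2 * x ^ 2)) + 2 * x * a * (y * b) := by
    rw [← h, ← h']; ring
  have hM : (y * b + (-(1 + k ^ 2) * x + 2 * k ^ 2 * x ^ 3) * a) * D +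
      2 * k ^ 2 * x * y * a ^ 2 * (x * b + y * a) =
      (y * b) * (1 + k ^ 2 * x ^ 2 * a ^ 2) + a * ((-(1 + k ^ 2) * x + 2 * k ^ 2 * x ^ 3) * D +
        2 * k ^ 2 * x * a ^ 2 * ((1 - x ^ 2) * (1 - k ^ 2 * x ^ 2))) := by
    rw [← h, hD]; ring
  have hq : (y * b) ^ 2 = ((1 - x ^ 2) * (1 - k ^ 2 * x ^ 2)) *
      ((1 - a ^ 2) * (1 - k ^ 2 * a ^ 2)) := by rw [← h, ← h']; ring
  rw [hM, div_pow, div_pow, hN]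
  -- By now `y` and `b` enter only through their product, whose square is a polynomial in `x` and
  -- `a`.
  generalize y * b = q at *
  field_simp
  rw [hD]
  linear_combination (1 - k ^ 2 * x ^ 2 * a ^ 2) ^ 2 * hq

namespace IsJacobiSn

variable {k : ℂ} {s : ℂ → ℂ} {a b : ℂ}

theorem hasDerivAt_snAdd (hs : IsJacobiSn k s) {z : ℂ} (hz : AnalyticAt ℂ s z)
    (hD : 1 - k ^ 2 * s z ^ 2 * a ^ 2 ≠ 0) :
    HasDerivAt (snAdd k s a b) (snAddDeriv k s a b z) z := by
  have e1 := hz.differentiableAt.hasDerivAt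
  have e2 := hz.deriv.differentiableAt.hasDerivAt
  rw [hs.deriv_deriv hz] at e2
  have e3 := ((e1.mul_const b).fun_add (e2.mul_const a)).fun_div
    ((((e1.fun_pow 2).const_mul (k ^ 2)).mul_const (a ^ 2)).const_sub 1) hD
  refine HasDerivAt.congr_deriv e3 ?_
  unfold snAddDeriv
  congr 1
  push_cast
  ring

theorem snAddDeriv_sq (hs : IsJacobiSn k s) (hab : b ^ 2 = (1 - a ^ 2) * (1 - k ^ 2 * a ^ 2))
    {z : ℂ} (hz : AnalyticAt ℂ s z) (hD : 1 - k ^ 2 * s z ^ 2 * a ^ 2 ≠ 0) :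
    snAddDeriv k s a b z ^ 2 =
      (1 - snAdd k s a b z ^ 2) * (1 - k ^ 2 * snAdd k s a b z ^ 2) :=
  snAdd_sq_identity rfl hD (hs.deriv_sq z hz) hab

/-- The subtraction formula: it recovers `a` from the sum and the summand `s z`, without `a` being
known to be a value of `s`. -/
theorem snAdd_sub (hs : IsJacobiSn k s) (hab : b ^ 2 = (1 - a ^ 2) * (1 - k ^ 2 * a ^ 2))
    {z : ℂ} (hz : AnalyticAt ℂ s z) (hD : 1 - k ^ 2 * s z ^ 2 * a ^ 2 ≠ 0) :
    snAdd k s a b z * deriv s z - snAddDeriv k s a b z * s z =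
      a * (1 - k ^ 2 * s z ^ 2 * snAdd k s a b z ^ 2) := by
  have h := hs.deriv_sq z hz
  unfold snAdd snAddDeriv
  generalize s z = x at *
  generalize deriv s z = y at *
  obtain ⟨D, hD'⟩ : ∃ D, D = 1 - k ^ 2 * x ^ 2 * a ^ 2 := ⟨_, rfl⟩
  rw [← hD'] at hD ⊢
  field_simp
  rw [hD']
  linear_combination (a * (1 - k ^ 2 * x ^ 2 * a ^ 2) - a ^ 3 * k ^ 2 * x ^ 2) * h +
    (a * k ^ 2 * x ^ 4) * hab

theorem snAdd_zero (hs : IsJacobiSn k s) : snAdd k s a b 0 = a := by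
  simp [snAdd, hs.map_zero, hs.deriv_zero]

theorem eventually_snAdd_denom_ne_zero (hs : IsJacobiSn k s) :
    ∀ᶠ z in 𝓝 0, 1 - k ^ 2 * s z ^ 2 * a ^ 2 ≠ 0 := by
  have := hs.analyticAt_zero
  have hc : ContinuousAt (fun z => 1 - k ^ 2 * s z ^ 2 * a ^ 2) 0 := by fun_prop
  exact hc.eventually_ne (by simp [hs.map_zero])

theorem analyticAt_snAdd {z : ℂ} (hz : AnalyticAt ℂ s z)
    (hD : 1 - k ^ 2 * s z ^ 2 * a ^ 2 ≠ 0) : AnalyticAt ℂ (snAdd k s a b) z := by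
  have := hz.deriv
  exact AnalyticAt.fun_div (by fun_prop) (by fun_prop) hD

theorem analyticAt_snAdd_zero (hs : IsJacobiSn k s) : AnalyticAt ℂ (snAdd k s a b) 0 :=
  analyticAt_snAdd hs.analyticAt_zero hs.eventually_snAdd_denom_ne_zero.self_of_nhds

/-- Both sides solve the first-order equation near `0` with the same value and derivative there. The
derivative `s' w` must not vanish, since otherwise the first-order equation does not determine the
solution. -/
theorem add_eventuallyEq_nhdsNE (hs : IsJacobiSn k s) {w : ℂ} (hw : AnalyticAt ℂ s w)
    (hw' : deriv s w ≠ 0) (z : ℂ) :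
    (fun x => s (x + w)) =ᶠ[𝓝[≠] z] snAdd k s (s w) (deriv s w) := by
  have hm := hs.meromorphic
  refine Meromorphic.eventuallyEq_nhdsNE (a := 0) (hm.comp_analytic fun _ => by fun_prop)
    (by unfold snAdd; fun_prop) (Filter.EventuallyEq.filter_mono ?_ nhdsWithin_le_nhds) z
  have hd : ∀ x, deriv (fun x => s (x + w)) x = deriv s (x + w) := fun x => by
    rw [deriv_comp_add_const]
  have ht : Tendsto (fun x => x + w) (𝓝 0) (𝓝 w) := by
    have : Continuous fun x => x + w := by fun_prop
    simpa using this.tendsto 0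
  have hD := hs.eventually_snAdd_denom_ne_zero (a := s w)
  refine AnalyticAt.eventuallyEq_of_sq_ode (k := k) ?_ hs.analyticAt_snAdd_zero ?_ ?_ ?_ ?_ ?_
  · exact AnalyticAt.fun_comp (g := s) (by simpa using hw) (by fun_prop)
  · filter_upwards [ht.eventually hw.eventually_analyticAt] with x hx
    rw [hd]
    exact hs.deriv_sq _ hx
  · filter_upwards [hs.analyticAt_zero.eventually_analyticAt, hD] with x hx hx'
    rw [(hs.hasDerivAt_snAdd hx hx').deriv]
    exact hs.snAddDeriv_sq (hs.deriv_sq w hw) hx hx'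
  · rw [hs.snAdd_zero, zero_add]
  · rw [hd, (hs.hasDerivAt_snAdd hs.analyticAt_zero hD.self_of_nhds).deriv]
    simp [snAddDeriv, hs.map_zero, hs.deriv_zero]
  · rwa [hd, zero_add]

theorem analyticAt_add (hs : IsJacobiSn k s) {z w : ℂ} (hz : AnalyticAt ℂ s z)
    (hw : AnalyticAt ℂ s w) (hw' : deriv s w ≠ 0) (hD : 1 - k ^ 2 * s z ^ 2 * s w ^ 2 ≠ 0) :
    AnalyticAt ℂ s (z + w) ∧ s (z + w) = snAdd k s (s w) (deriv s w) z := by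
  have h := hs.add_eventuallyEq_nhdsNE hw hw' z
  have ha : AnalyticAt ℂ (fun x => snAdd k s (s w) (deriv s w) (x - w)) (z + w) :=
    AnalyticAt.fun_comp (g := snAdd k s (s w) (deriv s w))
      (by simpa using analyticAt_snAdd hz hD) (by fun_prop)
  have ht : Tendsto (fun x => x - w) (𝓝[≠] (z + w)) (𝓝[≠] z) := by
    have : Continuous fun x => x - w := by fun_prop
    refine tendsto_nhdsWithin_iff.2 ⟨?_, ?_⟩
    · simpa using (this.tendsto (z + w)).mono_left nhdsWithin_le_nhds
    · filter_upwards [self_mem_nhdsWithin] with x hx hx'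
      exact hx (by rw [Set.mem_singleton_iff] at hx' ⊢; rw [← hx']; ring)
  have h2 : s =ᶠ[𝓝[≠] (z + w)] fun x => snAdd k s (s w) (deriv s w) (x - w) := by
    filter_upwards [ht.eventually h] with x hx
    simpa using hx
  refine ⟨hs.analyticAt_of_nhdsNE ha h2, ?_⟩
  simpa using (hs.eventuallyEq_of_nhdsNE ha h2).self_of_nhds

end IsJacobiSn

/-! ### Values, poles and reflection of `sn`. -/

namespace IsJacobiSn

variable {k : ℂ} {s : ℂ → ℂ} {a b : ℂ}

theorem eventually_ne_zero (hs : IsJacobiSn k s) : ∀ᶠ z in 𝓝[≠] 0, s z ≠ 0 := by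
  have := hs.analyticAt_zero.differentiableAt.hasDerivAt.eventually_ne (c := 0)
    (by rw [hs.deriv_zero]; exact one_ne_zero)
  simpa [hs.map_zero] using this

theorem not_eventually_const (hs : IsJacobiSn k s) (z c : ℂ) : ¬ ∀ᶠ w in 𝓝[≠] z, s w = c := by
  intro h
  have h1 := hs.meromorphic.eventuallyEq_nhdsNE (g := fun _ => c)
    (fun _ => MeromorphicAt.const _ _) h 0
  have h2 := (hs.eventuallyEq_of_nhdsNE analyticAt_const h1).deriv_eq
  rw [hs.deriv_zero] at h2
  simp at h2

theorem isOpen_range (hs : IsJacobiSn k s) : IsOpen {w | ∃ z, AnalyticAt ℂ s z ∧ s z = w} := by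
  rw [isOpen_iff_mem_nhds]
  rintro _ ⟨z, hz, rfl⟩
  rcases hz.eventually_constant_or_nhds_le_map_nhds with h | h
  · exact absurd (h.filter_mono nhdsWithin_le_nhds) (hs.not_eventually_const z _)
  · apply h
    exact mem_map.2 (hz.eventually_analyticAt.mono fun w hw => ⟨w, hw, rfl⟩)

/-- The derivative at `0` is `b`. If `b = 0`, then `a² = 1` or `k² a² = 1`, and the numerator of the
derivative is `a s` times a factor with value `±(k² - 1)` at `0`. -/
theorem snAdd_not_eventually_const (hs : IsJacobiSn k s) (hk : k ^ 2 ≠ 1)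
    (hab : b ^ 2 = (1 - a ^ 2) * (1 - k ^ 2 * a ^ 2)) :
    ¬ ∀ᶠ z in 𝓝 0, snAdd k s a b z = snAdd k s a b 0 := by
  intro h
  have hd : ∀ᶠ z in 𝓝 0, snAddDeriv k s a b z = 0 := by
    filter_upwards [eventually_eventually_nhds.2 h, hs.analyticAt_zero.eventually_analyticAt,
      hs.eventually_snAdd_denom_ne_zero (a := a)] with z h1 h2 h3
    rw [← (hs.hasDerivAt_snAdd h2 h3).deriv]
    exact (EventuallyEq.deriv_eq h1).trans (deriv_const _ _)
  have hb : b = 0 := by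
    have := hd.self_of_nhds
    simpa [snAddDeriv, hs.map_zero, hs.deriv_zero] using this
  subst hb
  have ha : a ≠ 0 := by
    rintro rfl
    simp at hab
  have hc : -(1 + k ^ 2) + 2 * k ^ 2 * a ^ 2 ≠ 0 := by
    intro h0
    apply hk
    rcases mul_eq_zero.1 ((zero_pow two_ne_zero).symm.trans hab).symm with h1 | h1
    · linear_combination h0 + 2 * k ^ 2 * h1
    · linear_combination -h0 - 2 * h1
  have hsa := hs.analyticAt_zero
  have hcont : ContinuousAt (fun z => (-(1 + k ^ 2) + 2 * k ^ 2 * s z ^ 2) *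
      (1 - k ^ 2 * s z ^ 2 * a ^ 2) +
      2 * k ^ 2 * a ^ 2 * ((1 - s z ^ 2) * (1 - k ^ 2 * s z ^ 2))) 0 := by fun_prop
  have hne := hcont.eventually_ne (y := 0) (by simpa [hs.map_zero] using hc)
  have hev : ∀ᶠ z in 𝓝[≠] (0 : ℂ), False := by
    filter_upwards [hd.filter_mono nhdsWithin_le_nhds, hne.filter_mono nhdsWithin_le_nhds,
      hs.eventually_ne_zero, hs.isSnGerm.deriv_sq.filter_mono nhdsWithin_le_nhds,
      (hs.eventually_snAdd_denom_ne_zero (a := a)).filter_mono nhdsWithin_le_nhds]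
      with z h1 h2 h3 h4 h5
    unfold snAddDeriv at h1
    rw [div_eq_zero_iff, or_iff_left (pow_ne_zero 2 h5)] at h1
    have h6 : (a * s z) * ((-(1 + k ^ 2) + 2 * k ^ 2 * s z ^ 2) * (1 - k ^ 2 * s z ^ 2 * a ^ 2) +
        2 * k ^ 2 * a ^ 2 * ((1 - s z ^ 2) * (1 - k ^ 2 * s z ^ 2))) = 0 := by
      rw [← h4]
      linear_combination h1
    exact mul_ne_zero (mul_ne_zero ha h3) h2 h6
  exact hev.exists.choose_spec

theorem exists_sq_eq (k a : ℂ) : ∃ b : ℂ, b ^ 2 = (1 - a ^ 2) * (1 - k ^ 2 * a ^ 2) :=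
  IsAlgClosed.exists_pow_nat_eq _ two_pos

/-- For `a` in the closure, formal addition of `(a, b)` is an open map near `0`, so it takes some
value `s z` at a small `t`. Subtracting `t` again shows that `a` is a value, at `z - t` or `z + t`.
-/
theorem isClosed_range (hs : IsJacobiSn k s) (hk : k ^ 2 ≠ 1) :
    IsClosed {w | ∃ z, AnalyticAt ℂ s z ∧ s z = w} := by
  refine isClosed_of_closure_subset fun a ha => ?_
  obtain ⟨b, hab⟩ := exists_sq_eq k a
  have hmap : 𝓝 a ≤ map (snAdd k s a b) (𝓝 0) := by
    have := (hs.analyticAt_snAdd_zero (a := a)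
      (b := b)).eventually_constant_or_nhds_le_map_nhds.resolve_left
      (hs.snAdd_not_eventually_const hk hab)
    rwa [hs.snAdd_zero] at this
  have hsa := hs.analyticAt_zero
  have hva := hs.analyticAt_snAdd_zero (a := a) (b := b)
  have hsd := hsa.deriv
  have hc : ContinuousAt (fun z => 1 - k ^ 2 * s z ^ 2 * snAdd k s a b z ^ 2) 0 := by fun_prop
  have hc0 := hc.eventually_ne (y := 0) (by simp [hs.map_zero])
  have hd0 := hsd.continuousAt.eventually_ne (y := 0) (by rw [hs.deriv_zero]; exact one_ne_zero)
  have hgood := image_mem_map (m := snAdd k s a b) ((hsa.eventually_analyticAt.and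
    (hs.eventually_snAdd_denom_ne_zero (a := a))).and (hc0.and hd0))
  obtain ⟨_, ⟨z, hz, hzw⟩, t, ⟨⟨ht1, ht2⟩, ht3, ht4⟩, rfl⟩ :=
    ((mem_closure_iff_frequently.1 ha).and_eventually (hmap hgood)).exists
  have hsq := hs.snAddDeriv_sq hab ht1 ht2
  have hsub := hs.snAdd_sub hab ht1 ht2
  rw [← hzw] at hsq hsub ht3
  rw [← hs.deriv_sq z hz] at hsq
  -- Equal values of `s` fix the derivative only up to sign; the sign decides between `z - t` and `z
  -- + t`.
  rcases sq_eq_sq_iff_eq_or_eq_neg.1 hsq with h | h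
  · have ht := hs.analyticAt_neg ht1
    have h4 := hs.analyticAt_add hz ht (by rwa [hs.deriv_neg ht1])
      (by rw [hs.map_neg ht1]; convert ht3 using 1; ring)
    refine ⟨_, h4.1, h4.2.trans ?_⟩
    unfold snAdd
    rw [hs.map_neg ht1, hs.deriv_neg ht1, div_eq_iff (by convert ht3 using 1; ring)]
    rw [h] at hsub
    linear_combination hsub
  · have h4 := hs.analyticAt_add hz ht1 ht4 (by convert ht3 using 1; ring)
    refine ⟨_, h4.1, h4.2.trans ?_⟩
    unfold snAdd
    rw [div_eq_iff (by convert ht3 using 1; ring)]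
    rw [h] at hsub
    linear_combination hsub

theorem surjective (hs : IsJacobiSn k s) (hk : k ^ 2 ≠ 1) (a : ℂ) :
    ∃ z, AnalyticAt ℂ s z ∧ s z = a := by
  have h := IsClopen.eq_univ ⟨hs.isClosed_range hk, hs.isOpen_range⟩
    ⟨s 0, 0, hs.analyticAt_zero, rfl⟩
  exact h.ge (Set.mem_univ a)

theorem duplication (hs : IsJacobiSn k s) (z : ℂ) :
    (fun w => s w * (1 - k ^ 2 * s (w / 2) ^ 4)) =ᶠ[𝓝[≠] z]
      fun w => 2 * s (w / 2) * deriv s (w / 2) := by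
  have hm := hs.meromorphic
  have h1 : Meromorphic fun w => s (w / 2) := hm.comp_analytic fun _ => by fun_prop
  have h2 : Meromorphic fun w => deriv s (w / 2) := hm.deriv.comp_analytic fun _ => by fun_prop
  refine Meromorphic.eventuallyEq_nhdsNE (a := 0)
    (hm.mul ((Meromorphic.const 1).sub ((Meromorphic.const (k ^ 2)).mul h1.pow)))
    (((Meromorphic.const 2).mul h1).mul h2)
    (Filter.EventuallyEq.filter_mono ?_ nhdsWithin_le_nhds) z
  have ht : Tendsto (fun z : ℂ => z / 2) (𝓝 0) (𝓝 0) := by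
    have : Continuous fun z : ℂ => z / 2 := by fun_prop
    simpa using this.tendsto 0
  have hsa := hs.analyticAt_zero
  have hc : ContinuousAt (fun z => 1 - k ^ 2 * s z ^ 4) 0 := by fun_prop
  have hc0 := hc.eventually_ne (y := 0) (by simp [hs.map_zero])
  filter_upwards [hs.isSnGerm.eventuallyEq hs.isSnGerm.snDouble, ht.eventually hc0] with w h3 h4
  change s w * (1 - k ^ 2 * s (w / 2) ^ 4) = 2 * s (w / 2) * deriv s (w / 2)
  rw [h3, snDouble, div_mul_cancel₀ _ h4]

/-- If `s(z)⁴ = 1/k²`, the denominator of the duplication formula vanishes. Regularity at `2z` would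
force `s' z = 0`, which for `s(z)² = 1/k` means `k = 1`. -/
theorem exists_not_analyticAt (hs : IsJacobiSn k s) (hk : k ^ 2 ≠ 1) (hk0 : k ≠ 0) :
    ∃ z, ¬ AnalyticAt ℂ s z := by
  obtain ⟨A, hA⟩ := IsAlgClosed.exists_pow_nat_eq k two_pos
  have hA0 : A ≠ 0 := by
    rintro rfl
    exact hk0 (by rw [← hA]; simp)
  obtain ⟨z, hz, hzA⟩ := hs.surjective hk (1 / A)
  refine ⟨2 * z, fun h => ?_⟩
  have hz2 : AnalyticAt ℂ s (2 * z / 2) := by rwa [mul_div_cancel_left₀ z two_ne_zero]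
  have h1 : AnalyticAt ℂ (fun w => s (w / 2)) (2 * z) :=
    AnalyticAt.fun_comp (g := s) hz2 (by fun_prop)
  have h2 : AnalyticAt ℂ (fun w => deriv s (w / 2)) (2 * z) :=
    AnalyticAt.fun_comp (g := deriv s) hz2.deriv (by fun_prop)
  have he := ((ContinuousAt.eventuallyEq_nhds_iff_eventuallyEq_nhdsNE
    (by fun_prop) (by fun_prop)).1 (hs.duplication (2 * z))).self_of_nhds
  simp only [mul_div_cancel_left₀ z (two_ne_zero' ℂ)] at he
  have hsq := hs.deriv_sq z hz
  have h4 : k ^ 2 * s z ^ 4 = 1 := by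
    rw [hzA, ← hA]; field_simp
  rw [h4, sub_self, mul_zero] at he
  have hd : deriv s z = 0 := by
    rw [hzA] at he
    have : 2 * (1 / A) ≠ 0 := mul_ne_zero two_ne_zero (one_div_ne_zero hA0)
    exact (mul_eq_zero.1 he.symm).resolve_left this
  rw [hd, hzA] at hsq
  have h5 : (1 - k) ^ 2 = 0 := by
    rw [← hA] at hsq ⊢
    field_simp at hsq
    linear_combination hsq
  apply hk
  have h6 : 1 - k = 0 := pow_eq_zero_iff two_ne_zero |>.1 h5
  linear_combination (-(1 + k)) * h6

/-- At a point `K` with `s K = 1` the derivative vanishes, so `s` and its reflection in `K` have the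
same data for the second-order equation. This reflection reverses the sign of `s'` while keeping
`s`. -/
theorem exists_reflection (hs : IsJacobiSn k s) (hk : k ^ 2 ≠ 1) :
    ∃ c : ℂ, ∀ z, AnalyticAt ℂ s z → AnalyticAt ℂ s (c - z) ∧ s (c - z) = s z ∧
      deriv s (c - z) = -deriv s z := by
  obtain ⟨K, hK, hK1⟩ := hs.surjective hk 1
  have hK' : deriv s K = 0 := by
    have := hs.deriv_sq K hK
    rw [hK1] at this
    simpa using this
  have hKK : 2 * K - K = K := by ring
  have hd : ∀ z, deriv (fun w => s (2 * K - w)) z = -deriv s (2 * K - z) := fun z =>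
    deriv_comp_const_sub _ _ _
  have hr : AnalyticAt ℂ (fun w => s (2 * K - w)) K :=
    AnalyticAt.fun_comp (g := s) (by rwa [hKK]) (by fun_prop)
  have ht : Tendsto (fun w => 2 * K - w) (𝓝 K) (𝓝 K) := by
    have : Continuous fun w => 2 * K - w := by fun_prop
    simpa [hKK] using this.tendsto K
  have h0 : s =ᶠ[𝓝 K] fun w => s (2 * K - w) := by
    have h1 := hs.eventually_deriv_deriv hK
    refine hK.eventuallyEq_of_second_order_ode hr h1 ?_ (by simp [hKK]) (by simp [hd, hKK, hK'])
    filter_upwards [ht.eventually h1] with z hz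
    rw [show deriv (fun w => s (2 * K - w)) = fun z => -deriv s (2 * K - z) from funext hd,
      deriv.fun_neg, deriv_comp_const_sub, neg_neg, hz]
  refine ⟨2 * K, fun z hz => ?_⟩
  have hzz : 2 * K - (2 * K - z) = z := by ring
  have ha : AnalyticAt ℂ (fun w => s (2 * K - w)) (2 * K - z) :=
    AnalyticAt.fun_comp (g := s) (by rwa [hzz]) (by fun_prop)
  have h1 := hs.meromorphic.eventuallyEq_nhdsNE
    (hs.meromorphic.comp_analytic fun _ => by fun_prop)
    (h0.filter_mono nhdsWithin_le_nhds) (2 * K - z)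
  have h2 := hs.eventuallyEq_of_nhdsNE ha h1
  exact ⟨hs.analyticAt_of_nhdsNE ha h1, by simpa only [hzz] using h2.self_of_nhds,
    by rw [h2.deriv_eq, hd, hzz]⟩

theorem exists_point (hs : IsJacobiSn k s) (hk : k ^ 2 ≠ 1)
    (hab : b ^ 2 = (1 - a ^ 2) * (1 - k ^ 2 * a ^ 2)) :
    ∃ z, AnalyticAt ℂ s z ∧ s z = a ∧ deriv s z = b := by
  obtain ⟨z, hz, rfl⟩ := hs.surjective hk a
  rw [← hs.deriv_sq z hz] at hab
  rcases sq_eq_sq_iff_eq_or_eq_neg.1 hab with h | h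
  · exact ⟨z, hz, rfl, h.symm⟩
  · obtain ⟨c, hc⟩ := hs.exists_reflection hk
    obtain ⟨h1, h2, h3⟩ := hc z hz
    exact ⟨c - z, h1, h2, h3.trans h.symm⟩

end IsJacobiSn

/-! ### Limits of the roots of a quadratic polynomial. -/

theorem tendsto_add_const_nhdsNE (z p : ℂ) : Tendsto (fun w => w + p) (𝓝[≠] z) (𝓝[≠] (z + p)) := by
  have : Continuous fun x : ℂ => x + p := by fun_prop
  refine tendsto_nhdsWithin_iff.2 ⟨(this.tendsto z).mono_left nhdsWithin_le_nhds, ?_⟩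
  filter_upwards [self_mem_nhdsWithin] with x hx hx'
  exact hx (add_right_cancel hx')

/-- A meromorphic function that does not tend to `f` stays away from `f`: `G - f` has order at most
`0`. -/
theorem MeromorphicAt.exists_tendsto_inv_sub {G : ℂ → ℂ} {z f : ℂ} (hG : MeromorphicAt G z)
    (h : ¬ Tendsto G (𝓝[≠] z) (𝓝 f)) :
    (∃ α, Tendsto (fun w => (G w - f)⁻¹) (𝓝[≠] z) (𝓝 α)) ∧ ∀ᶠ w in 𝓝[≠] z, G w - f ≠ 0 := by
  have hm : MeromorphicAt (fun w => G w - f) z := hG.fun_sub (MeromorphicAt.const f z)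
  have ho : ¬ 0 < meromorphicOrderAt (fun w => G w - f) z := fun h0 =>
    h (by simpa using (tendsto_zero_of_meromorphicOrderAt_pos h0).add_const f)
  have ho' := not_lt.1 ho
  constructor
  · refine (tendsto_nhds_iff_meromorphicOrderAt_nonneg hm.inv).2 ?_
    rw [meromorphicOrderAt_inv]
    have ht : meromorphicOrderAt (fun w => G w - f) z ≠ ⊤ := fun h => by simp [h] at ho'
    lift meromorphicOrderAt (fun w => G w - f) z to ℤ using ht with n
    norm_cast at ho' ⊢
    omega
  · exact (meromorphicOrderAt_ne_top_iff_eventually_ne_zero hm).1 fun h => by simp [h] at ho'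

/-- If the coefficients of a quadratic polynomial with meromorphic roots converge to those of a
nonzero polynomial, then every root of the latter is the limit of one of the roots. -/
theorem MeromorphicAt.tendsto_root {G₁ G₂ a b d : ℂ → ℂ} {z f a₀ b₀ d₀ : ℂ}
    (h₁ : MeromorphicAt G₁ z) (h₂ : MeromorphicAt G₂ z)
    (ha : Tendsto a (𝓝[≠] z) (𝓝 a₀)) (hb : Tendsto b (𝓝[≠] z) (𝓝 b₀))
    (hd : Tendsto d (𝓝[≠] z) (𝓝 d₀))
    (hsum : ∀ᶠ w in 𝓝[≠] z, (G₁ w + G₂ w) * a w = -b w)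
    (hprod : ∀ᶠ w in 𝓝[≠] z, G₁ w * G₂ w * a w = d w)
    (hf : a₀ * f ^ 2 + b₀ * f + d₀ = 0) (hne : a₀ = 0 → d₀ = 0 → b₀ ≠ 0) :
    Tendsto G₁ (𝓝[≠] z) (𝓝 f) ∨ Tendsto G₂ (𝓝[≠] z) (𝓝 f) := by
  by_contra hcon
  rw [not_or] at hcon
  obtain ⟨⟨α₁, hα₁⟩, hn₁⟩ := h₁.exists_tendsto_inv_sub hcon.1
  obtain ⟨⟨α₂, hα₂⟩, hn₂⟩ := h₂.exists_tendsto_inv_sub hcon.2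
  have hq : Tendsto (fun w => a w * f ^ 2 + b w * f + d w) (𝓝[≠] z) (𝓝 0) := by
    rw [← hf]
    exact ((ha.mul_const _).add (hb.mul_const _)).add hd
  -- With `q = a (G₁ - f)(G₂ - f) → 0`, bounded inverses force `a` and then `q'(f)` to tend to `0`,
  -- so the limit polynomial is zero. A root may escape to infinity, so `a₀ = 0` is allowed.
  have e1 : a₀ = 0 * (α₁ * α₂) := by
    refine tendsto_nhds_unique ha ((hq.mul (hα₁.mul hα₂)).congr' ?_)
    filter_upwards [hn₁, hn₂, hsum, hprod] with w h1 h2 h3 h4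
    field_simp
    linear_combination -h4 + f * h3
  have e2 : 2 * a₀ * f + b₀ = -(0 * (α₁ + α₂)) := by
    refine tendsto_nhds_unique (((ha.const_mul 2).mul_const f).add hb)
      ((hq.mul (hα₁.add hα₂)).neg.congr' ?_)
    filter_upwards [hn₁, hn₂, hsum, hprod] with w h1 h2 h3 h4
    have h5 : a w * f ^ 2 + b w * f + d w = a w * ((G₁ w - f) * (G₂ w - f)) := by
      linear_combination -h4 + f * h3
    rw [h5]
    field_simp
    linear_combination -h3
  rw [zero_mul] at e1
  rw [zero_mul, neg_zero, e1, mul_zero, zero_mul, zero_add] at e2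
  rw [e1, e2] at hf
  exact hne e1 (by simpa using hf) e2

/-! ### Euler's normal form and its parametrization. -/

/-- Vieta's relations for Euler's form turn into those for the `f`-quadratic. The sum and product of
the new roots need only `(c ± F₁)(c ± F₂)` and `c² - F₁ F₂`, which `r₁`–`r₄` evaluate. -/
theorem moebius_vieta {c F F₁ F₂ t E γ ζ : ℂ} (hζ : ζ ≠ 0) (hF : F ^ 2 + γ ≠ 0)
    (h : c - F ≠ 0) (h₁ : c - F₁ ≠ 0) (h₂ : c - F₂ ≠ 0)
    (hsum : (F ^ 2 + γ) * (F₁ + F₂) = -ζ * F) (hprod : (F ^ 2 + γ) * (F₁ * F₂) = γ * F ^ 2 + 1)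
    (r₁ : 2 * (c ^ 2 + γ) = ζ * (1 - t)) (r₂ : 2 * (c ^ 2 * γ + 1) = ζ * (1 + t) * c ^ 2)
    (r₃ : 4 * (c ^ 2 - γ) = -ζ * (E + 2 * t))
    (r₄ : 4 * (c ^ 2 * γ - 1) = ζ * (E - 2 * t) * c ^ 2) :
    ((c + F₁) / (c - F₁)) * ((c + F₂) / (c - F₂)) *
        ((c + F) / (c - F) * ((c + F) / (c - F) + t)) = 1 + t * ((c + F) / (c - F)) ∧
    ((c + F₁) / (c - F₁) + (c + F₂) / (c - F₂)) *
        ((c + F) / (c - F) * ((c + F) / (c - F) + t)) =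
      -(t * ((c + F) / (c - F)) ^ 2 + t - E * ((c + F) / (c - F))) := by
  have hm : 2 * (F ^ 2 + γ) * ((c - F₁) * (c - F₂)) =
      ζ * ((c + F) * ((1 + t) * c + (1 - t) * F)) := by
    linear_combination 2 * hprod - 2 * c * hsum + F ^ 2 * r₁ + r₂
  have hp : 2 * (F ^ 2 + γ) * ((c + F₁) * (c + F₂)) =
      ζ * ((c - F) * ((1 + t) * c - (1 - t) * F)) := by
    linear_combination 2 * hprod + 2 * c * hsum + F ^ 2 * r₁ + r₂
  have hd : 4 * (F ^ 2 + γ) * (c ^ 2 - F₁ * F₂) =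
      ζ * ((E - 2 * t) * c ^ 2 - (E + 2 * t) * F ^ 2) := by
    linear_combination -4 * hprod + F ^ 2 * r₃ + r₄
  constructor
  · field_simp
    apply mul_left_cancel₀ (mul_ne_zero two_ne_zero hF)
    linear_combination (c + F) * (c + F + t * (c - F)) * hp -
      (c - F) * (c - F + t * (c + F)) * hm
  · field_simp
    apply mul_left_cancel₀ hζ
    linear_combination (c - F₁) * (c - F₂) * hd - 2 * (c ^ 2 - F₁ * F₂) * hm

/-- The function `(c + A s) / (c - A s)`. -/
noncomputable def moebiusSn (c A : ℂ) (s : ℂ → ℂ) (z : ℂ) : ℂ := (c + A * s z) / (c - A * s z)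

namespace IsJacobiSn

variable {k A c : ℂ} {s : ℂ → ℂ}

theorem meromorphic_moebiusSn (hs : IsJacobiSn k s) : Meromorphic (moebiusSn c A s) := by
  have := hs.meromorphic
  unfold moebiusSn
  fun_prop

theorem eventually_sub_ne_zero (hs : IsJacobiSn k s) (hA : A ≠ 0) (z : ℂ) :
    ∀ᶠ w in 𝓝[≠] z, c - A * s w ≠ 0 := by
  have hm : Meromorphic fun w => c - A * s w := by
    have := hs.meromorphic
    fun_prop
  refine (hm z).eventually_eq_zero_or_eventually_ne_zero.resolve_left fun h =>
    hs.not_eventually_const z (c / A) ?_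
  filter_upwards [h] with w hw
  rw [eq_div_iff hA]
  linear_combination -hw

theorem analyticAt_of_tendsto (hs : IsJacobiSn k s) {z a : ℂ}
    (h : Tendsto s (𝓝[≠] z) (𝓝 a)) : AnalyticAt ℂ s z ∧ s z = a := by
  have h1 : AnalyticAt ℂ s z :=
    ((hs.meromorphicNFOn (Set.mem_univ z)).meromorphicOrderAt_nonneg_iff_analyticAt).1
      ((tendsto_nhds_iff_meromorphicOrderAt_nonneg (hs.meromorphic z)).1 ⟨a, h⟩)
  exact ⟨h1, tendsto_nhds_unique (h1.continuousAt.tendsto.mono_left nhdsWithin_le_nhds) h⟩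

theorem tendsto_cobounded (hs : IsJacobiSn k s) {z : ℂ} (h : ¬ AnalyticAt ℂ s z) :
    Tendsto s (𝓝[≠] z) (Bornology.cobounded ℂ) := by
  refine tendsto_cobounded_of_meromorphicOrderAt_neg (not_le.1 fun h' => h ?_)
  exact ((hs.meromorphicNFOn (Set.mem_univ z)).meromorphicOrderAt_nonneg_iff_analyticAt).1 h'

/-- This replaces points of the sphere by punctured limits in `ℂ`: a pole of `sn` becomes the
ordinary limit `-1`, and default values of divisions play no role. -/
theorem scaledSn_eq_iff (hs : IsJacobiSn k (jacobiSn k)) (hA : A ≠ 0) (hc : c ≠ 0) {z φ : ℂ} :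
    scaledSn A k z = moebiusF c φ ↔
      Tendsto (moebiusSn c A (jacobiSn k)) (𝓝[≠] z) (𝓝 φ) := by
  have hne := hs.eventually_sub_ne_zero (c := c) hA z
  unfold scaledSn moebiusF
  constructor
  · intro h
    by_cases hφ : φ = -1
    · have hz : ¬ AnalyticAt ℂ (jacobiSn k) z := by
        intro hz
        rw [if_pos hφ, if_pos hz] at h
        exact OnePoint.coe_ne_infty _ h
      have h1 : Tendsto (fun w => c - A * jacobiSn k w) (𝓝[≠] z) (Bornology.cobounded ℂ) := by
        have h2 := (Filter.tendsto_mul_left_cobounded hA).comp (hs.tendsto_cobounded hz)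
        exact (tendsto_const_sub_cobounded c).comp h2
      have h3 := ((tendsto_inv₀_cobounded.comp h1).const_mul (2 * c)).sub_const 1
      rw [mul_zero, zero_sub, ← hφ] at h3
      refine h3.congr' ?_
      filter_upwards [hne] with w hw
      simp only [Function.comp_apply, moebiusSn]
      field_simp
      ring
    · have hφ' : φ + 1 ≠ 0 := fun h' => hφ (eq_neg_of_add_eq_zero_left h')
      rw [if_neg hφ] at h
      split_ifs at h with hz
      · have h1 := OnePoint.coe_eq_coe.1 h
        have h2 : c - A * jacobiSn k z = 2 * c / (φ + 1) := by
          rw [h1]; field_simp; ring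
        have h3 : c - A * jacobiSn k z ≠ 0 := by
          rw [h2]; exact div_ne_zero (mul_ne_zero two_ne_zero hc) hφ'
        have h4 : ContinuousAt (moebiusSn c A (jacobiSn k)) z :=
          ContinuousAt.div (by fun_prop) (by fun_prop) h3
        have h5 : moebiusSn c A (jacobiSn k) z = φ := by
          rw [moebiusSn, h2, h1]; field_simp; ring
        have h6 := h4.tendsto.mono_left (nhdsWithin_le_nhds (s := {z}ᶜ))
        rwa [h5] at h6
      · exact absurd h (OnePoint.infty_ne_coe _)
  · intro h
    have hrel : ∀ᶠ w in 𝓝[≠] z, A * jacobiSn k w * (moebiusSn c A (jacobiSn k) w + 1) =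
        c * (moebiusSn c A (jacobiSn k) w - 1) := by
      filter_upwards [hne] with w hw
      unfold moebiusSn
      field_simp
      ring
    by_cases hφ : φ = -1
    · rw [if_pos hφ, if_neg]
      intro hz
      have h1 := tendsto_nhds_unique_of_eventuallyEq
        (((hz.continuousAt.tendsto.mono_left nhdsWithin_le_nhds).const_mul A).mul
          (h.add_const 1)) ((h.sub_const 1).const_mul c) hrel
      rw [hφ] at h1
      apply hc
      linear_combination (1 / 2 : ℂ) * h1
    · have hφ' : φ + 1 ≠ 0 := fun h' => hφ (eq_neg_of_add_eq_zero_left h')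
      have h1 : Tendsto (jacobiSn k) (𝓝[≠] z) (𝓝 (c * (φ - 1) / (φ + 1) / A)) := by
        refine ((((h.sub_const 1).const_mul c).div (h.add_const 1) hφ').div_const A).congr' ?_
        filter_upwards [hrel, (h.add_const 1).eventually_ne hφ'] with w h2 h3
        change c * (moebiusSn c A (jacobiSn k) w - 1) / (moebiusSn c A (jacobiSn k) w + 1) / A = _
        rw [← h2]
        field_simp
      obtain ⟨h2, h3⟩ := hs.analyticAt_of_tendsto h1
      rw [if_neg hφ, if_pos h2, h3, mul_div_cancel₀ _ hA]

theorem moebiusSn_vieta {t E γ ζ p : ℂ} (hs : IsJacobiSn k s) (hA : A ^ 2 = k) (hA0 : A ≠ 0)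
    (hγ : γ ≠ 0) (hζ : ζ ≠ 0) (hp : AnalyticAt ℂ s p) (hp1 : k * s p ^ 2 = -1 / γ)
    (hp2 : deriv s p = -ζ / (2 * γ))
    (r₁ : 2 * (c ^ 2 + γ) = ζ * (1 - t)) (r₂ : 2 * (c ^ 2 * γ + 1) = ζ * (1 + t) * c ^ 2)
    (r₃ : 4 * (c ^ 2 - γ) = -ζ * (E + 2 * t))
    (r₄ : 4 * (c ^ 2 * γ - 1) = ζ * (E - 2 * t) * c ^ 2) (z : ℂ) :
    ∀ᶠ w in 𝓝[≠] z,
      moebiusSn c A s (w + p) * moebiusSn c A s (w + -p) *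
        (moebiusSn c A s w * (moebiusSn c A s w + t)) = 1 + t * moebiusSn c A s w ∧
      (moebiusSn c A s (w + p) + moebiusSn c A s (w + -p)) *
        (moebiusSn c A s w * (moebiusSn c A s w + t)) =
        -(t * moebiusSn c A s w ^ 2 + t - E * moebiusSn c A s w) := by
  have hη : deriv s p ≠ 0 := by
    rw [hp2]
    exact div_ne_zero (neg_ne_zero.2 hζ) (mul_ne_zero two_ne_zero hγ)
  have hFa : ∀ᶠ w in 𝓝[≠] z, (A * s w) ^ 2 + γ ≠ 0 := by
    have hm : Meromorphic fun w => (A * s w) ^ 2 + γ := by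
      have := hs.meromorphic
      fun_prop
    obtain ⟨g, hg⟩ := IsAlgClosed.exists_pow_nat_eq (-γ) two_pos
    filter_upwards [hs.eventually_sub_ne_zero (c := g) hA0 z,
      hs.eventually_sub_ne_zero (c := -g) hA0 z] with w h1 h2 h3
    have : (g - A * s w) * (-g - A * s w) = 0 := by linear_combination h3 - hg
    exact mul_ne_zero h1 h2 this
  have hnp := hs.analyticAt_neg hp
  have hadd := hs.add_eventuallyEq_nhdsNE hp hη z
  have hsub := hs.add_eventuallyEq_nhdsNE hnp (by rwa [hs.deriv_neg hp]) z
  filter_upwards [hFa, hadd, hsub, hs.eventually_sub_ne_zero (c := c) hA0 z,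
    (tendsto_add_const_nhdsNE z p).eventually (hs.eventually_sub_ne_zero (c := c) hA0 (z + p)),
    (tendsto_add_const_nhdsNE z (-p)).eventually
      (hs.eventually_sub_ne_zero (c := c) hA0 (z + -p)),
    (hs.meromorphic z).eventually_analyticAt] with w h0 h1 h2 h3 h4 h5 h6
  have hsq := hs.deriv_sq w h6
  have hpq := hs.deriv_sq p hp
  rw [hs.map_neg hp, hs.deriv_neg hp] at h2
  unfold snAdd at h1 h2
  rw [neg_sq] at h2
  have hkσ : γ * k * s p ^ 2 = -1 := by
    rw [mul_assoc, hp1]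
    field_simp
  have hη' : 2 * γ * deriv s p = -ζ := by
    rw [hp2]
    field_simp
  obtain ⟨D, hD⟩ : ∃ D, D = 1 - k ^ 2 * s w ^ 2 * s p ^ 2 := ⟨_, rfl⟩
  have hFD : (A * s w) ^ 2 + γ = γ * D := by
    rw [hD]
    linear_combination s w ^ 2 * hA + k * s w ^ 2 * hkσ
  have hD0 : D ≠ 0 := by
    rintro rfl
    exact h0 (by rw [hFD, mul_zero])
  rw [← hD] at h1 h2
  refine moebius_vieta hζ h0 h3 h4 h5 ?_ ?_ r₁ r₂ r₃ r₄
  · rw [h1, h2, hFD]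
    field_simp
    linear_combination s w * hη'
  · rw [h1, h2, hFD]
    -- The classical `sn(w + p) sn(w - p) = (sn² w - sn² p) / D`, with denominators cleared.
    have h7 : (s w * deriv s p + deriv s w * s p) * (s w * deriv s p + deriv s w * -s p) =
        (s w ^ 2 - s p ^ 2) * D := by
      rw [hD]
      linear_combination s w ^ 2 * hpq - s p ^ 2 * hsq
    calc γ * D * (A * ((s w * deriv s p + deriv s w * s p) / D) *
          (A * ((s w * deriv s p + deriv s w * -s p) / D)))
        = γ * A ^ 2 * ((s w * deriv s p + deriv s w * s p) *
          (s w * deriv s p + deriv s w * -s p)) / D := by field_simp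
      _ = γ * A ^ 2 * (s w ^ 2 - s p ^ 2) := by rw [h7]; field_simp
      _ = γ * (A * s w) ^ 2 + 1 := by
        rw [← hA] at hkσ
        linear_combination -hkσ

end IsJacobiSn

/-! ### Convergence to the autonomous orbit. -/

/-- Since `L = x + 1/x + y + 1/y` is invariant under inversion of `x`, this serves for `u = x` and
for `u = 1/x`, excluding both limits `0` and `∞`. -/
theorem not_tendsto_zero_of_bounded_qP2L {l : Filter ℂ} [l.NeBot] {u y L : ℂ → ℂ} {Y : ℂ} {J : ℝ}
    (hu : Tendsto u l (𝓝 0)) (hy : Tendsto y l (𝓝 Y)) (hY : Y ≠ 0)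
    (hL : ∀ᶠ ε in l, ‖L ε‖ ≤ J)
    (h : ∀ᶠ ε in l, L ε * (u ε * y ε) = (u ε + y ε) * (1 + u ε * y ε)) : False := by
  have h1 : Tendsto (fun ε => u ε * L ε) l (𝓝 0) :=
    hu.zero_mul_isBoundedUnder_le ⟨J, by simpa using hL⟩
  have h2 := tendsto_nhds_unique_of_eventuallyEq (h1.mul hy)
    ((hu.add hy).mul ((hu.mul hy).const_add 1))
    (h.mono fun ε hε => by linear_combination hε)
  apply hY
  linear_combination -h2

theorem qP2_limit_step {l : Filter ℂ} [l.NeBot] {x y w τ : ℂ → ℂ} {Y W t E : ℂ} {J : ℝ}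
    (hy : Tendsto y l (𝓝 Y)) (hw : Tendsto w l (𝓝 W)) (hτ : Tendsto τ l (𝓝 t))
    (hY : Y ≠ 0) (hW : W ≠ 0) (ht : t ≠ 0) (hE : qP2E 1 t Y W = E) (hE2 : E ≠ -2)
    (hx : ∀ ε, x ε = 1 * (1 + y ε * τ ε) / (y ε * (y ε + τ ε) * w ε))
    (hx0 : ∀ᶠ ε in l, x ε ≠ 0) (hL : ∀ᶠ ε in l, ‖qP2L 1 (x ε) (y ε)‖ ≤ J) :
    Y + t ≠ 0 ∧ Tendsto x l (𝓝 (1 * (1 + Y * t) / (Y * (Y + t) * W))) ∧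
      1 * (1 + Y * t) / (Y * (Y + t) * W) ≠ 0 ∧
      qP2E 1 t (1 * (1 + Y * t) / (Y * (Y + t) * W)) Y = E := by
  have hden : Tendsto (fun ε => y ε * (y ε + τ ε) * w ε) l (𝓝 (Y * (Y + t) * W)) :=
    (hy.mul (hy.add hτ)).mul hw
  have hnum : Tendsto (fun ε => 1 * (1 + y ε * τ ε)) l (𝓝 (1 * (1 + Y * t))) :=
    ((hy.mul hτ).const_add 1).const_mul 1
  have hy0 := hy.eventually_ne hY
  unfold qP2E at hE
  rw [div_eq_iff (mul_ne_zero hY hW)] at hE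
  have hYt : Y + t ≠ 0 := by
    intro h
    have hYt' : Y = -t := eq_neg_of_add_eq_zero_left h
    -- If `Y = -t` and the numerator vanished too, then `t² = 1` and the first integral would equal
    -- `-2`.
    have hne : 1 * (1 + Y * t) ≠ 0 := by
      intro h1
      apply hE2
      rw [hYt'] at hE h1
      have h2 : t * W * (E + 2) = 0 := by linear_combination hE + (t * W - 1) * h1
      have := (mul_eq_zero.1 h2).resolve_left (mul_ne_zero ht hW)
      linear_combination this
    have hu : Tendsto (fun ε => (x ε)⁻¹) l (𝓝 0) := by
      have h1 := hden.div hnum hne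
      rw [h, mul_zero, zero_mul, zero_div] at h1
      refine h1.congr fun ε => ?_
      rw [hx, inv_div]
      rfl
    refine not_tendsto_zero_of_bounded_qP2L hu hy hY hL ?_
    filter_upwards [hx0, hy0] with ε h1 h2
    unfold qP2L
    field_simp
  have hX : Tendsto x l (𝓝 (1 * (1 + Y * t) / (Y * (Y + t) * W))) :=
    (hnum.div hden (mul_ne_zero (mul_ne_zero hY hYt) hW)).congr fun ε => (hx ε).symm
  have hX0 : 1 * (1 + Y * t) / (Y * (Y + t) * W) ≠ 0 := by
    intro h
    rw [h] at hX
    refine not_tendsto_zero_of_bounded_qP2L hX hy hY hL ?_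
    filter_upwards [hx0, hy0] with ε h1 h2
    unfold qP2L
    field_simp
  refine ⟨hYt, hX, hX0, ?_⟩
  have hXW : 1 * (1 + Y * t) / (Y * (Y + t) * W) * (Y * (Y + t) * W) = 1 + Y * t := by
    field_simp
  generalize 1 * (1 + Y * t) / (Y * (Y + t) * W) = X at hXW hX0 ⊢
  unfold qP2E
  rw [div_eq_iff (mul_ne_zero hX0 hY)]
  apply mul_left_cancel₀ hW
  -- `W` and `X` are the two roots of one quadratic with coefficients in `Y`.
  linear_combination X * hE + (X - W) * hXW

theorem tendsto_qP2Time (t : ℂ) (n : ℕ) : Tendsto (fun ε => qP2Time t ε n) (𝓝[≠] 0) (𝓝 t) := by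
  have : Continuous fun ε => qP2Time t ε n := by unfold qP2Time; fun_prop
  simpa [qP2Time] using (this.tendsto 0).mono_left (nhdsWithin_le_nhds (s := {0}ᶜ))

theorem qP2Seq_zero_add_two (t f₀ f₁ : ℂ) (n : ℕ) :
    qP2Seq 1 t 0 f₀ f₁ (n + 2) = 1 * (1 + qP2Seq 1 t 0 f₀ f₁ (n + 1) * t) /
      (qP2Seq 1 t 0 f₀ f₁ (n + 1) * (qP2Seq 1 t 0 f₀ f₁ (n + 1) + t) *
        qP2Seq 1 t 0 f₀ f₁ n) := by
  rw [qP2Seq]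
  simp [qP2Time]

/-- The limit of a bounded solution is an orbit of the autonomous equation. -/
theorem QP2Bounded.limit {t f₀ f₁ E : ℂ} {N : ℕ} (h : QP2Bounded 1 t f₀ f₁ N) (ht : t ≠ 0)
    (hf₀ : f₀ ≠ 0) (hf₁ : f₁ ≠ 0) (hE : qP2E 1 t f₁ f₀ = E) (hE2 : E ≠ -2) :
    ∀ n ≤ N, qP2Seq 1 t 0 f₀ f₁ n ≠ 0 ∧ qP2Seq 1 t 0 f₀ f₁ (n + 1) ≠ 0 ∧
      Tendsto (fun ε => qP2Seq 1 t ε f₀ f₁ n) (𝓝[≠] 0) (𝓝 (qP2Seq 1 t 0 f₀ f₁ n)) ∧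
      Tendsto (fun ε => qP2Seq 1 t ε f₀ f₁ (n + 1)) (𝓝[≠] 0)
        (𝓝 (qP2Seq 1 t 0 f₀ f₁ (n + 1))) ∧
      qP2E 1 t (qP2Seq 1 t 0 f₀ f₁ (n + 1)) (qP2Seq 1 t 0 f₀ f₁ n) = E ∧
      (n + 1 ≤ N → qP2Seq 1 t 0 f₀ f₁ (n + 1) + t ≠ 0) := by
  obtain ⟨J, hJ⟩ := h
  have step : ∀ n, n + 1 ≤ N → qP2Seq 1 t 0 f₀ f₁ n ≠ 0 → qP2Seq 1 t 0 f₀ f₁ (n + 1) ≠ 0 →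
      Tendsto (fun ε => qP2Seq 1 t ε f₀ f₁ n) (𝓝[≠] 0) (𝓝 (qP2Seq 1 t 0 f₀ f₁ n)) →
      Tendsto (fun ε => qP2Seq 1 t ε f₀ f₁ (n + 1)) (𝓝[≠] 0)
        (𝓝 (qP2Seq 1 t 0 f₀ f₁ (n + 1))) →
      qP2E 1 t (qP2Seq 1 t 0 f₀ f₁ (n + 1)) (qP2Seq 1 t 0 f₀ f₁ n) = E →
      qP2Seq 1 t 0 f₀ f₁ (n + 1) + t ≠ 0 ∧
      Tendsto (fun ε => qP2Seq 1 t ε f₀ f₁ (n + 2)) (𝓝[≠] 0)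
        (𝓝 (qP2Seq 1 t 0 f₀ f₁ (n + 2))) ∧ qP2Seq 1 t 0 f₀ f₁ (n + 2) ≠ 0 ∧
      qP2E 1 t (qP2Seq 1 t 0 f₀ f₁ (n + 2)) (qP2Seq 1 t 0 f₀ f₁ (n + 1)) = E := by
    intro n hn h0 h1 h2 h3 h4
    rw [qP2Seq_zero_add_two]
    exact qP2_limit_step (x := fun ε => qP2Seq 1 t ε f₀ f₁ (n + 2)) h3 h2
      (tendsto_qP2Time t (n + 1)) h1 h0 ht h4 hE2 (fun ε => by rw [qP2Seq])
      (hJ.mono fun ε hε => (hε (n + 1) hn).2.1) (hJ.mono fun ε hε => (hε (n + 1) hn).2.2)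
  intro n
  induction n with
  | zero =>
    intro _
    have h0 : ∀ ε, qP2Seq 1 t ε f₀ f₁ 0 = f₀ := fun ε => by rw [qP2Seq]
    have h1 : ∀ ε, qP2Seq 1 t ε f₀ f₁ (0 + 1) = f₁ := fun ε => by rw [qP2Seq]
    have h2 : Tendsto (fun ε => qP2Seq 1 t ε f₀ f₁ 0) (𝓝[≠] 0) (𝓝 (qP2Seq 1 t 0 f₀ f₁ 0)) := by
      simp only [h0, tendsto_const_nhds]
    have h3 : Tendsto (fun ε => qP2Seq 1 t ε f₀ f₁ (0 + 1)) (𝓝[≠] 0)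
        (𝓝 (qP2Seq 1 t 0 f₀ f₁ (0 + 1))) := by
      simp only [h1, tendsto_const_nhds]
    have h4 : qP2E 1 t (qP2Seq 1 t 0 f₀ f₁ (0 + 1)) (qP2Seq 1 t 0 f₀ f₁ 0) = E := by
      rw [h0, h1, hE]
    have h5 : qP2Seq 1 t 0 f₀ f₁ 0 ≠ 0 := by rwa [h0]
    have h6 : qP2Seq 1 t 0 f₀ f₁ (0 + 1) ≠ 0 := by rwa [h1]
    exact ⟨h5, h6, h2, h3, h4, fun hn => (step 0 hn h5 h6 h2 h3 h4).1⟩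
  | succ n ih =>
    intro hn
    obtain ⟨h0, h1, h2, h3, h4, -⟩ := ih (by omega)
    obtain ⟨-, h5, h6, h7⟩ := step n hn h0 h1 h2 h3 h4
    exact ⟨h1, h6, h3, h5, h7, fun hn' => (step (n + 1) hn' h1 h6 h3 h5 h7).1⟩

/-! ### The modulus, and the passage to the Riemann sphere. -/

/-- The roots are `k` and `1/k`. On the unit circle they are conjugate, so `β = -2 Re k` would lie
in `[-2, 2]`. -/
theorem existsUnique_root_norm_lt_one {β : ℂ}
    (hβ : ¬ ∃ x : ℝ, -2 ≤ x ∧ x ≤ 2 ∧ β = (x : ℂ)) :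
    ∃! k : ℂ, 0 < ‖k‖ ∧ ‖k‖ < 1 ∧ k ^ 2 + β * k + 1 = 0 := by
  have hroot : ∃ k : ℂ, k ^ 2 + β * k + 1 = 0 := by
    obtain ⟨δ, hδ⟩ := IsAlgClosed.exists_pow_nat_eq (β ^ 2 - 4) two_pos
    exact ⟨(-β + δ) / 2, by linear_combination (1 / 4 : ℂ) * hδ⟩
  have hne : ∀ k : ℂ, k ^ 2 + β * k + 1 = 0 → k ≠ 0 := by
    rintro k h rfl
    simp at h
  have hinv : ∀ k : ℂ, k ^ 2 + β * k + 1 = 0 → k⁻¹ ^ 2 + β * k⁻¹ + 1 = 0 := by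
    intro k h
    have := hne k h
    field_simp
    linear_combination h
  have hnorm : ∀ k : ℂ, k ^ 2 + β * k + 1 = 0 → ‖k‖ ≠ 1 := by
    intro k h h1
    have hk := hne k h
    have hconj : k⁻¹ = starRingEnd ℂ k := Complex.inv_eq_conj h1
    have hre := Complex.abs_re_le_norm k
    rw [h1, abs_le] at hre
    refine hβ ⟨-(2 * k.re), by linarith, by linarith, ?_⟩
    have h2 : β = -(k + k⁻¹) := by
      field_simp
      linear_combination h
    rw [h2, hconj, Complex.add_conj]
    push_cast
    ring
  have hex : ∃ k : ℂ, 0 < ‖k‖ ∧ ‖k‖ < 1 ∧ k ^ 2 + β * k + 1 = 0 := by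
    obtain ⟨k, hk⟩ := hroot
    rcases lt_or_gt_of_ne (hnorm k hk) with h | h
    · exact ⟨k, norm_pos_iff.2 (hne k hk), h, hk⟩
    · refine ⟨k⁻¹, norm_pos_iff.2 (inv_ne_zero (hne k hk)), ?_, hinv k hk⟩
      rw [norm_inv]
      exact inv_lt_one_of_one_lt₀ h
  obtain ⟨k, hk0, hk1, hk⟩ := hex
  refine ⟨k, ⟨hk0, hk1, hk⟩, ?_⟩
  rintro m ⟨hm0, hm1, hm⟩
  by_contra hmk
  have h1 : k * m = 1 := by
    have h2 : (m - k) * (m + k + β) = 0 := by linear_combination hm - hk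
    have h3 := (mul_eq_zero.1 h2).resolve_left (sub_ne_zero.2 hmk)
    linear_combination k * h3 - hk
  have h2 : ‖k‖ * ‖m‖ = 1 := by rw [← norm_mul, h1, norm_one]
  nlinarith

theorem continuous_moebiusF {c : ℂ} (hc : c ≠ 0) : Continuous (moebiusF c) := by
  rw [continuous_iff_continuousAt]
  intro f
  by_cases hf : f = -1
  · subst hf
    rw [← continuousWithinAt_compl_self]
    have h0 : moebiusF c (-1) = OnePoint.infty := by simp [moebiusF]
    unfold ContinuousWithinAt
    rw [h0]
    have h1 : Tendsto (fun f : ℂ => c * (f - 1) / (f + 1)) (𝓝[≠] (-1))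
        (Bornology.cobounded ℂ) := by
      have h2 : Tendsto (fun f : ℂ => (f + 1) / (c * (f - 1))) (𝓝[≠] (-1)) (𝓝[≠] 0) := by
        refine tendsto_nhdsWithin_iff.2 ⟨?_, ?_⟩
        · have : ContinuousAt (fun f : ℂ => (f + 1) / (c * (f - 1))) (-1) :=
            ContinuousAt.div (by fun_prop) (by fun_prop) (by norm_num [hc])
          simpa using this.tendsto.mono_left nhdsWithin_le_nhds
        · have h3 : ∀ᶠ f : ℂ in 𝓝[≠] (-1), f ≠ 1 :=
            (eventually_ne_nhds (by norm_num)).filter_mono nhdsWithin_le_nhds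
          filter_upwards [self_mem_nhdsWithin, h3] with f h4 h5
          refine div_ne_zero (fun h => h4 (eq_neg_of_add_eq_zero_left h)) ?_
          exact mul_ne_zero hc (sub_ne_zero.2 h5)
      refine (tendsto_inv₀_nhdsNE_zero.comp h2).congr fun f => ?_
      simp
    have h2 := OnePoint.tendsto_coe_infty (X := ℂ)
    rw [Filter.coclosedCompact_eq_cocompact, ← Metric.cobounded_eq_cocompact] at h2
    refine (h2.comp h1).congr' ?_
    filter_upwards [self_mem_nhdsWithin] with f h4
    exact (if_neg h4).symm
  · have h1 : (fun f : ℂ => ((c * (f - 1) / (f + 1) : ℂ) : OnePoint ℂ)) =ᶠ[𝓝 f] moebiusF c := by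
      filter_upwards [eventually_ne_nhds hf] with g hg
      exact (if_neg hg).symm
    refine ContinuousAt.congr ?_ h1
    have h2 : ContinuousAt (fun f : ℂ => c * (f - 1) / (f + 1)) f :=
      ContinuousAt.div (by fun_prop) (by fun_prop) fun h => hf (eq_neg_of_add_eq_zero_left h)
    exact OnePoint.continuous_coe.continuousAt.comp h2

theorem exists_scaledSn_eq {A k : ℂ} (hs : IsJacobiSn k (jacobiSn k)) (hk : k ^ 2 ≠ 1)
    (hk0 : k ≠ 0) (hA : A ≠ 0) (x : OnePoint ℂ) : ∃ z, scaledSn A k z = x := by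
  induction x using OnePoint.rec with
  | infty =>
    obtain ⟨z, hz⟩ := hs.exists_not_analyticAt hk hk0
    exact ⟨z, if_neg hz⟩
  | coe x =>
    obtain ⟨z, hz, h⟩ := hs.surjective hk (x / A)
    exact ⟨z, by rw [scaledSn, if_pos hz, h, mul_div_cancel₀ _ hA]⟩

/-! ### The orbit as a translation, and the conclusion. -/

/-- The function `moebiusSn` parametrizes the orbits of the autonomous equation. -/
theorem tendsto_moebiusSn_orbit {g : ℂ → ℂ} {t z p : ℂ} {φ : ℕ → ℂ} {N : ℕ}
    (hg : ∀ z, ∀ᶠ w in 𝓝[≠] z, g (w + p) * g (w + -p) * (g w * (g w + t)) = 1 + t * g w)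
    (h0 : Tendsto g (𝓝[≠] z) (𝓝 (φ 0))) (h1 : Tendsto g (𝓝[≠] (z + p)) (𝓝 (φ 1)))
    (hφ : ∀ n ≤ N + 1, φ n ≠ 0) (hφt : ∀ n < N, φ (n + 1) + t ≠ 0)
    (hrec : ∀ n, φ (n + 2) =
      1 * (1 + φ (n + 1) * t) / (φ (n + 1) * (φ (n + 1) + t) * φ n)) :
    ∀ n ≤ N, Tendsto g (𝓝[≠] (z + p * n)) (𝓝 (φ n)) ∧
      Tendsto g (𝓝[≠] (z + p * (n + 1 : ℕ))) (𝓝 (φ (n + 1))) := by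
  intro n
  induction n with
  | zero => exact fun _ => ⟨by simpa using h0, by simpa using h1⟩
  | succ n ih =>
    intro hn
    obtain ⟨h2, h3⟩ := ih (by omega)
    refine ⟨h3, ?_⟩
    set u := z + p * (n + 1 : ℕ) with hu
    have hm : Tendsto (fun w => g (w + -p)) (𝓝[≠] u) (𝓝 (φ n)) := by
      have := tendsto_add_const_nhdsNE u (-p)
      rw [show u + -p = z + p * n by rw [hu]; push_cast; ring] at this
      exact h2.comp this
    have hden : φ (n + 1) * (φ (n + 1) + t) * φ n ≠ 0 :=
      mul_ne_zero (mul_ne_zero (hφ _ (by omega)) (hφt n (by omega))) (hφ _ (by omega))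
    have hd := (h3.mul (h3.add_const t)).mul hm
    have h4 : Tendsto (fun w => g (w + p)) (𝓝[≠] u) (𝓝 (φ (n + 2))) := by
      rw [hrec]
      refine ((((h3.mul_const t).const_add 1).const_mul 1).div hd hden).congr' ?_
      filter_upwards [hg u, hd.eventually_ne hden] with w h5 h6
      refine (div_eq_iff h6).2 ?_
      linear_combination -h5
    have h7 := tendsto_add_const_nhdsNE (u + p) (-p)
    rw [add_neg_cancel_right] at h7
    rw [show z + p * ((n + 1 + 1 : ℕ) : ℂ) = u + p by rw [hu]; push_cast; ring]
    exact (h4.comp h7).congr fun w => by simp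

/-- Near `z₀` the translates by `p` and `-p` are the two roots of the quadratic, and `f₁` is a root
of its limit; this decides the sign of `p`. -/
theorem exists_moebiusSn_shift {k A c t E γ ζ f₀ f₁ z₀ : ℂ} {s : ℂ → ℂ} (hs : IsJacobiSn k s)
    (hk : k ^ 2 ≠ 1) (hA : A ^ 2 = k) (hA0 : A ≠ 0) (hγ : γ ≠ 0) (hζ : ζ ≠ 0)
    (hkγ : 4 * γ * (k ^ 2 + 1) + (4 + 4 * γ ^ 2 - ζ ^ 2) * k = 0)
    (r₁ : 2 * (c ^ 2 + γ) = ζ * (1 - t)) (r₂ : 2 * (c ^ 2 * γ + 1) = ζ * (1 + t) * c ^ 2)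
    (r₃ : 4 * (c ^ 2 - γ) = -ζ * (E + 2 * t))
    (r₄ : 4 * (c ^ 2 * γ - 1) = ζ * (E - 2 * t) * c ^ 2)
    (ht : t ≠ 0) (hf₀ : f₀ ≠ 0) (hf₁ : f₁ ≠ 0) (hE : qP2E 1 t f₁ f₀ = E) (hE2 : E ≠ -2)
    (hz₀ : Tendsto (moebiusSn c A s) (𝓝[≠] z₀) (𝓝 f₀)) :
    ∃ p, k * s p ^ 2 = -1 / γ ∧ Tendsto (moebiusSn c A s) (𝓝[≠] (z₀ + p)) (𝓝 f₁) ∧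
      ∀ z, ∀ᶠ w in 𝓝[≠] z, moebiusSn c A s (w + p) * moebiusSn c A s (w + -p) *
        (moebiusSn c A s w * (moebiusSn c A s w + t)) = 1 + t * moebiusSn c A s w := by
  have hk0 : k ≠ 0 := by
    rw [← hA]
    exact pow_ne_zero 2 hA0
  obtain ⟨σ, hσ⟩ := IsAlgClosed.exists_pow_nat_eq (-1 / (k * γ)) two_pos
  -- The equation for `k`, rewritten: the required values of `s p` and `s' p` satisfy the elliptic
  -- equation.
  have hση : (-ζ / (2 * γ)) ^ 2 = (1 - σ ^ 2) * (1 - k ^ 2 * σ ^ 2) := by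
    rw [hσ]
    field_simp
    linear_combination -hkγ
  obtain ⟨p, hp, hp1, hp2⟩ := hs.exists_point hk hση
  have hkp : k * s p ^ 2 = -1 / γ := by
    rw [hp1, hσ]
    field_simp
  have hnp := hs.analyticAt_neg hp
  have hknp : k * s (-p) ^ 2 = -1 / γ := by rw [hs.map_neg hp, neg_sq, hkp]
  have hv := hs.moebiusSn_vieta hA hA0 hγ hζ hp hkp hp2 r₁ r₂ r₃ r₄
  have hvn := hs.moebiusSn_vieta hA hA0 hγ hζ hnp hknp ((hs.deriv_neg hp).trans hp2) r₁ r₂ r₃ r₄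
  have hm := hs.meromorphic_moebiusSn (c := c) (A := A)
  unfold qP2E at hE
  rw [div_eq_iff (mul_ne_zero hf₁ hf₀)] at hE
  have hshift : ∀ q, Tendsto (fun w => moebiusSn c A s (w + q)) (𝓝[≠] z₀) (𝓝 f₁) →
      Tendsto (moebiusSn c A s) (𝓝[≠] (z₀ + q)) (𝓝 f₁) := by
    intro q hq
    have h7 := tendsto_add_const_nhdsNE (z₀ + q) (-q)
    rw [add_neg_cancel_right] at h7
    exact (hq.comp h7).congr fun w => by simp
  have hroot := MeromorphicAt.tendsto_root (z := z₀) (f := f₁)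
    (hm.comp_analytic (g := fun w => w + p) (fun _ => by fun_prop) z₀)
    (hm.comp_analytic (g := fun w => w + -p) (fun _ => by fun_prop) z₀)
    (hz₀.mul (hz₀.add_const t))
    ((((hz₀.pow 2).const_mul t).add_const t).sub (hz₀.const_mul E))
    ((hz₀.const_mul t).const_add 1)
    ((hv z₀).mono fun _ h => h.2) ((hv z₀).mono fun _ h => h.1)
    (by linear_combination hE)
    -- The quadratic at `f₀` vanishes identically only for `f₀ = -t`, `t² = 1`, `E = -2`.
    (by
      intro h1 h2 h3
      have h4 := (mul_eq_zero.1 h1).resolve_left hf₀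
      have h5 : f₀ = -t := eq_neg_of_add_eq_zero_left h4
      rw [h5] at h2 h3
      apply hE2
      have h6 : t * (E + 2) = 0 := by linear_combination h3 + t * h2
      linear_combination (mul_eq_zero.1 h6).resolve_left ht)
  rcases hroot with h | h
  · exact ⟨p, hkp, hshift p h, fun z => (hv z).mono fun _ h => h.1⟩
  · exact ⟨-p, hknp, hshift (-p) h, fun z => (hvn z).mono fun _ h => h.1⟩

theorem mainTheorem1 (t₀ f₀ f₁ E₀ c γ ζ β : ℂ)
    (ht₀ : t₀ ≠ 0) (hf₀ : f₀ ≠ 0) (hf₁ : f₁ ≠ 0)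
    (hE₀ : E₀ = qP2E 1 t₀ f₁ f₀)
    (hE_add : E₀ ≠ 2 + 4 * t₀) (hE_sub : E₀ ≠ 2 - 4 * t₀) (hE_two : E₀ ≠ -2)
    (hc₀ : c ≠ 0) (hc : c ^ 4 = (2 - E₀ - 4 * t₀) / (2 - E₀ + 4 * t₀))
    (hγ : γ = (2 + E₀) * c ^ 2 / (2 - E₀ - 4 * t₀))
    (hζ : ζ = 8 * c ^ 2 / (2 - E₀ - 4 * t₀))
    (hβ : β = (4 + 4 * γ ^ 2 - ζ ^ 2) / (4 * γ))
    (hβ_mem : ¬ ∃ x : ℝ, -2 ≤ x ∧ x ≤ 2 ∧ β = (x : ℂ)) :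
    (∃! k : ℂ, 0 < ‖k‖ ∧ ‖k‖ < 1 ∧ k ^ 2 + β * k + 1 = 0) ∧
    ∀ k : ℂ, 0 < ‖k‖ → ‖k‖ < 1 → k ^ 2 + β * k + 1 = 0 →
      IsJacobiSn k (jacobiSn k) ∧
      ∀ A : ℂ, A ^ 2 = k →
        (∃ z₀ : ℂ, scaledSn A k z₀ = moebiusF c f₀) ∧
        ∀ z₀ : ℂ, scaledSn A k z₀ = moebiusF c f₀ →
          ∃ p : ℂ, k * jacobiSn k p ^ 2 = -1 / γ ∧
            ∀ N : ℕ, QP2Bounded 1 t₀ f₀ f₁ N → ∀ n ≤ N + 1,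
              Tendsto (fun ε : ℂ => moebiusF c (qP2Seq 1 t₀ ε f₀ f₁ n)) (𝓝[≠] 0)
                (𝓝 (scaledSn A k (z₀ + p * n))) := by

  have hD : 2 - E₀ - 4 * t₀ ≠ 0 := fun h => hE_sub (by linear_combination -h)
  have hD' : 2 - E₀ + 4 * t₀ ≠ 0 := fun h => hE_add (by linear_combination -h)
  have hE2 : 2 + E₀ ≠ 0 := fun h => hE_two (by linear_combination h)
  have hγ0 : γ ≠ 0 := by
    rw [hγ]
    exact div_ne_zero (mul_ne_zero hE2 (pow_ne_zero 2 hc₀)) hD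
  have hζ0 : ζ ≠ 0 := by
    rw [hζ]
    exact div_ne_zero (mul_ne_zero (by norm_num) (pow_ne_zero 2 hc₀)) hD
  have hc4 : c ^ 4 * (2 - E₀ + 4 * t₀) = 2 - E₀ - 4 * t₀ := by
    rw [hc, div_mul_cancel₀ _ hD']
  -- `r₁` and `r₃` hold by the choice of `γ` and `ζ`; `r₂` and `r₄` also need the value of `c⁴`.
  have r₁ : 2 * (c ^ 2 + γ) = ζ * (1 - t₀) := by
    rw [hγ, hζ]
    field_simp
    ring
  have r₂ : 2 * (c ^ 2 * γ + 1) = ζ * (1 + t₀) * c ^ 2 := by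
    rw [hγ, hζ]
    field_simp
    linear_combination -2 * hc4
  have r₃ : 4 * (c ^ 2 - γ) = -ζ * (E₀ + 2 * t₀) := by
    rw [hγ, hζ]
    field_simp
    ring
  have r₄ : 4 * (c ^ 2 * γ - 1) = ζ * (E₀ - 2 * t₀) * c ^ 2 := by
    rw [hγ, hζ]
    field_simp
    linear_combination 4 * hc4
  refine ⟨existsUnique_root_norm_lt_one hβ_mem, fun k hk0 hk1 hkβ => ?_⟩
  have hs := isJacobiSn_jacobiSn k
  have hk : k ^ 2 ≠ 1 := by
    intro h
    have h1 : ‖k‖ ^ 2 = 1 := by rw [← norm_pow, h, norm_one]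
    nlinarith
  refine ⟨hs, fun A hA => ?_⟩
  have hk0' : k ≠ 0 := norm_pos_iff.1 hk0
  have hA0 : A ≠ 0 := by
    rintro rfl
    exact hk0' (by rw [← hA]; simp)
  refine ⟨exists_scaledSn_eq hs hk hk0' hA0 _, fun z₀ hz₀ => ?_⟩
  have hkγ : 4 * γ * (k ^ 2 + 1) + (4 + 4 * γ ^ 2 - ζ ^ 2) * k = 0 := by
    have h1 : 4 * γ * β = 4 + 4 * γ ^ 2 - ζ ^ 2 := by
      rw [hβ]
      field_simp
    linear_combination 4 * γ * hkβ - k * h1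
  have hV := (hs.scaledSn_eq_iff hA0 hc₀).1 hz₀
  obtain ⟨p, hp, hp1, hg⟩ := exists_moebiusSn_shift hs hk hA hA0 hγ0 hζ0 hkγ r₁ r₂ r₃ r₄ ht₀ hf₀ hf₁
    hE₀.symm hE_two hV
  refine ⟨p, hp, fun N hN => ?_⟩
  have hlim := hN.limit ht₀ hf₀ hf₁ hE₀.symm hE_two
  have horb := tendsto_moebiusSn_orbit (N := N) (φ := qP2Seq 1 t₀ 0 f₀ f₁) hg
    (by rwa [qP2Seq]) (by rwa [qP2Seq])
    (by
      intro n hn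
      rcases Nat.le_succ_iff.1 hn with h | rfl
      · exact (hlim n h).1
      · exact (hlim N le_rfl).2.1)
    (fun n hn => (hlim n hn.le).2.2.2.2.2 hn) (qP2Seq_zero_add_two t₀ f₀ f₁)
  intro n hn
  obtain ⟨h1, h2⟩ : Tendsto (fun ε => qP2Seq 1 t₀ ε f₀ f₁ n) (𝓝[≠] 0)
      (𝓝 (qP2Seq 1 t₀ 0 f₀ f₁ n)) ∧ Tendsto (moebiusSn c A (jacobiSn k)) (𝓝[≠] (z₀ + p * n))
      (𝓝 (qP2Seq 1 t₀ 0 f₀ f₁ n)) := by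
    rcases Nat.le_succ_iff.1 hn with h | rfl
    · exact ⟨(hlim n h).2.2.1, (horb n h).1⟩
    · exact ⟨(hlim N le_rfl).2.2.2.1, (horb N le_rfl).2⟩
  rw [(hs.scaledSn_eq_iff hA0 hc₀).2 h2]
  exact ((continuous_moebiusF hc₀).tendsto _).comp h1
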